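/- For $s,r\in\mathbb{R}$ let $$\Im_{s,r}=\{f\in L^2(\mathbb{R};\mathbb{C}) : (1-\partial_x^2)^{s/2}f\in L^2(\mathbb{R}),\ |x|^r f\in L^2(\mathbb{R})\},\qquad \|f\|_{\Im_{s,r}}^2=\|(1-\partial_x^2)^{s/2}f\|_{L^2}^2+\||x|^r f\|_{L^2}^2 .$$ Let $\mathcal H$ be the Hilbert transform (the Fourier multiplier with symbol $-i\,\mathrm{sgn}(\xi)$), let $A=-\partial_x(1+\mathcal H\partial_x)^{-1}$, which is a bounded operator on $L^2(\mathbb{R})$ (in angular frequency its symbol is $-i\xi/(1+|\xi|)$), and let $E(t)=e^{tA}$ for $t\in\mathbb{R}$. Let $r\ge 0$ be an integer. 1. If $r\in\{0,1,2\}$, there is a polynomial $P_r$ of degree $r$, all of whose coefficients of order $0,\dots,r$ are positive, such that for every real $s\ge r$, every $\varphi\in\Im_{s,r}$ and every $t\in\mathbb{R}$ one has $E(t)\varphi\in\Im_{s,r}$ and $$\|E(t)\varphi\|_{\Im_{s,r}}\le P_r(|t|)\,\|\varphi\|_{\Im_{s,r}} .$$ 2. If $r\ge 3$, then for every real $s\ge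 r$ and every $\varphi\in\Im_{s,r}$: $E(\cdot)\varphi\in C([0,\infty);\Im_{s,r})$ if and only if $$(\partial_\xi^j\widehat\varphi)(0)=0\qquad (j=0,1,\dots,r-3).$$ Moreover there is a polynomial $P_r$ of degree $r$, all of whose coefficients of order $0,\dots,r$ are positive, such that for every real $s\ge r$ and every $\varphi\in\Im_{s,r}$ satisfying these conditions, $E(t)\varphi\in\Im_{s,r}$ and $\|E(t)\varphi\|_{\Im_{s,r}}\le P_r(|t|)\|\varphi\|_{\Im_{s,r}}$ for all $t\in\mathbb{R}$. (For $r\ge3$ and $\varphi\in\Im_{s,r}$ the function $\varphi$ is integrable and its Fourier transform $\widehat\varphi$ is of class $C^{r-1}$, so the derivatives exist; the conditions do not depend on the normalization of the Fourier transform.) -/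

import Mathlib

open MeasureTheory FourierTransform
open scoped ENNReal

noncomputable section

namespace RBO

/-- The complex Hilbert space `L²(ℝ)`. -/
abbrev L2R : Type := Lp ℂ 2 (volume : Measure ℝ)

/-! ### Fourier multipliers on `L²(ℝ)`

Mathlib's Fourier transform is `𝓕 f ξ = ∫ e^{-2πi x ξ} f x dx`, so the angular frequency is `2πξ`. -/

/-- The Fourier multiplier `f ↦ 𝓕⁻¹ (m · 𝓕 f)` on `L²(ℝ)` with a bounded symbol `m`. -/
def fourierMultiplier (m : Lp ℂ ∞ (volume : Measure ℝ)) : L2R →L[ℂ] L2R :=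
  ((Lp.fourierTransformₗᵢ ℝ ℂ).symm : L2R →L[ℂ] L2R) ∘L
    ((ContinuousLinearMap.mul ℂ ℂ).holderL (volume : Measure ℝ) ∞ 2 2 m) ∘L
    ((Lp.fourierTransformₗᵢ ℝ ℂ) : L2R →L[ℂ] L2R)

/-- The symbol of `∂ₓ`. -/
def symbolDeriv (ξ : ℝ) : ℂ := 2 * (Real.pi : ℂ) * Complex.I * (ξ : ℂ)

/-- The symbol of the Hilbert transform `ℋ`. -/
def symbolHilbert (ξ : ℝ) : ℂ := -Complex.I * ((Real.sign ξ : ℝ) : ℂ)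

/-- The symbol of `A = -∂ₓ (1 + ℋ ∂ₓ)⁻¹`. -/
def symbolA (ξ : ℝ) : ℂ := -symbolDeriv ξ * (1 + symbolHilbert ξ * symbolDeriv ξ)⁻¹

/-- In angular frequency `η = 2πξ`, the symbol of `A` is `-iη / (1 + |η|)`. -/
lemma symbolA_eq (ξ : ℝ) :
    symbolA ξ =
      -Complex.I * ((2 * Real.pi * ξ : ℝ) : ℂ) / ((1 + |2 * Real.pi * ξ| : ℝ) : ℂ) := by
  have h : symbolHilbert ξ * symbolDeriv ξ = ((|2 * Real.pi * ξ| : ℝ) : ℂ) := by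
    have h1 : |2 * Real.pi * ξ| = 2 * Real.pi * (Real.sign ξ * ξ) := by
      rw [abs_mul, abs_of_pos Real.two_pi_pos]
      congr 1
      rcases lt_trichotomy ξ 0 with h | h | h
      · rw [Real.sign_of_neg h, abs_of_neg h]; ring
      · simp [h]
      · rw [Real.sign_of_pos h, abs_of_pos h]; ring
    rw [h1]
    simp only [symbolHilbert, symbolDeriv]
    push_cast
    linear_combination (-2 * (Real.pi : ℂ) * (Real.sign ξ : ℂ) * ξ) * Complex.I_sq
  rw [symbolA, h, symbolDeriv, div_eq_mul_inv]
  push_cast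
  ring

lemma norm_symbolA_le (ξ : ℝ) : ‖symbolA ξ‖ ≤ 1 := by
  rw [symbolA_eq, norm_div, norm_mul, norm_neg, Complex.norm_I, Complex.norm_real,
    Complex.norm_real, Real.norm_eq_abs, Real.norm_eq_abs, one_mul,
    abs_of_pos (a := 1 + _) (by positivity)]
  exact div_le_one_of_le₀ (by linarith) (by positivity)

lemma memLp_symbolA : MemLp symbolA ∞ (volume : Measure ℝ) := by
  refine memLp_top_of_bound ?_ 1 (Filter.Eventually.of_forall norm_symbolA_le)
  have h : symbolA = fun ξ : ℝ ↦
      -Complex.I * ((2 * Real.pi * ξ : ℝ) : ℂ) / ((1 + |2 * Real.pi * ξ| : ℝ) : ℂ) :=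
    funext symbolA_eq
  rw [h]
  exact Measurable.aestronglyMeasurable (by fun_prop)

/-- The bounded operator `A = -∂ₓ (1 + ℋ ∂ₓ)⁻¹` on `L²(ℝ)`. -/
def generator : L2R →L[ℂ] L2R := fourierMultiplier (memLp_symbolA.toLp symbolA)

/-- The linear rBO group `E(t) = e^{tA}`, the exponential of a bounded operator. -/
def group (t : ℝ) : L2R →L[ℂ] L2R := NormedSpace.exp ((t : ℂ) • generator)

/-! ### The weighted Sobolev spaces `H^s(ℝ) ∩ L²_r(ℝ)` -/

/-- The Fourier weight of `(1 - ∂ₓ²)^{s/2}`. -/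
def sobolevWeight (s ξ : ℝ) : ℝ := (1 + (2 * Real.pi * ξ) ^ 2) ^ (s / 2)

/-- The `f ∈ L²(ℝ)` for which `(1 - ∂ₓ²)^{s/2} f` (seen on the Fourier side) and `|x|^r f`
are in `L²(ℝ)`. -/
def weightedSobolevSubmodule (s r : ℝ) : Submodule ℂ L2R where
  carrier := {f | MemLp (fun ξ ↦ (sobolevWeight s ξ : ℂ) * (𝓕 f : L2R) ξ) 2 volume ∧
    MemLp (fun x ↦ ((|x| ^ r : ℝ) : ℂ) * f x) 2 volume}
  zero_mem' := by
    constructor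
    · refine (memLp_congr_ae ?_).2 (MemLp.zero (ε := ℂ))
      rw [FourierTransform.fourier_zero]
      filter_upwards [Lp.coeFn_zero ℂ 2 (volume : Measure ℝ)] with x hx
      simp only [hx, Pi.zero_apply, mul_zero]
    · refine (memLp_congr_ae ?_).2 (MemLp.zero (ε := ℂ))
      filter_upwards [Lp.coeFn_zero ℂ 2 (volume : Measure ℝ)] with x hx
      simp only [hx, Pi.zero_apply, mul_zero]
  add_mem' := by
    rintro f g ⟨hf, hf'⟩ ⟨hg, hg'⟩
    constructor
    · refine (memLp_congr_ae ?_).2 (hf.add hg)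
      rw [FourierTransform.fourier_add]
      filter_upwards [Lp.coeFn_add (𝓕 f : L2R) (𝓕 g)] with x hx
      simp only [hx, Pi.add_apply, mul_add]
    · refine (memLp_congr_ae ?_).2 (hf'.add hg')
      filter_upwards [Lp.coeFn_add f g] with x hx
      simp only [hx, Pi.add_apply, mul_add]
  smul_mem' := by
    rintro c f ⟨hf, hf'⟩
    constructor
    · refine (memLp_congr_ae ?_).2 (hf.const_smul c)
      rw [FourierTransform.fourier_smul]
      filter_upwards [Lp.coeFn_smul c (𝓕 f : L2R)] with x hx
      simp only [hx, Pi.smul_apply, smul_eq_mul]; ring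
    · refine (memLp_congr_ae ?_).2 (hf'.const_smul c)
      filter_upwards [Lp.coeFn_smul c f] with x hx
      simp only [hx, Pi.smul_apply, smul_eq_mul]; ring

/-- The space `H^s(ℝ) ∩ L²_r(ℝ)`. It is a type of its own, since its norm is not the one of
`L²(ℝ)`. -/
def WeightedSobolev (s r : ℝ) : Type := ↥(weightedSobolevSubmodule s r)

namespace WeightedSobolev

variable {s r : ℝ}

instance : AddCommGroup (WeightedSobolev s r) :=
  inferInstanceAs (AddCommGroup ↥(weightedSobolevSubmodule s r))

instance : Module ℂ (WeightedSobolev s r) :=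
  inferInstanceAs (Module ℂ ↥(weightedSobolevSubmodule s r))

/-- The inclusion of `H^s(ℝ) ∩ L²_r(ℝ)` into `L²(ℝ)`. -/
def toL2 : WeightedSobolev s r →ₗ[ℂ] L2R := (weightedSobolevSubmodule s r).subtype

lemma toL2_injective : Function.Injective (toL2 : WeightedSobolev s r → L2R) :=
  Subtype.val_injective

lemma memLp_sobolev (f : WeightedSobolev s r) :
    MemLp (fun ξ ↦ (sobolevWeight s ξ : ℂ) * (𝓕 f.toL2 : L2R) ξ) 2 volume :=
  f.2.1

lemma memLp_weight (f : WeightedSobolev s r) :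
    MemLp (fun x ↦ ((|x| ^ r : ℝ) : ℂ) * f.toL2 x) 2 volume :=
  f.2.2

/-- The map `f ↦ ((1 + η²)^{s/2} 𝓕 f, |x|^r f)` into `L²(ℝ) × L²(ℝ)` with its Hilbert norm;
it induces the norm of `H^s(ℝ) ∩ L²_r(ℝ)`. -/
def embed : WeightedSobolev s r →+ WithLp 2 (L2R × L2R) :=
  AddMonoidHom.mk' (fun f ↦ WithLp.toLp 2 (f.memLp_sobolev.toLp _, f.memLp_weight.toLp _)) <| by
    intro f g
    rw [← WithLp.toLp_add, Prod.mk_add_mk, ← MemLp.toLp_add, ← MemLp.toLp_add]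
    congr 2
    · refine MemLp.toLp_congr _ _ ?_
      rw [map_add, FourierTransform.fourier_add]
      filter_upwards [Lp.coeFn_add (𝓕 f.toL2 : L2R) (𝓕 g.toL2)] with x hx
      simp only [hx, Pi.add_apply, mul_add]
    · refine MemLp.toLp_congr _ _ ?_
      rw [map_add]
      filter_upwards [Lp.coeFn_add f.toL2 g.toL2] with x hx
      simp only [hx, Pi.add_apply, mul_add]

lemma embed_injective : Function.Injective (embed : WeightedSobolev s r → _) := by
  rw [injective_iff_map_eq_zero]
  intro f hf
  have h1 : f.memLp_sobolev.toLp _ = 0 := congrArg (fun p : WithLp 2 (L2R × L2R) ↦ p.fst) hf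
  rw [Lp.eq_zero_iff_ae_eq_zero] at h1
  have h2 : (𝓕 f.toL2 : L2R) = 0 := by
    rw [Lp.eq_zero_iff_ae_eq_zero]
    filter_upwards [h1, f.memLp_sobolev.coeFn_toLp] with x hx hx'
    rw [hx'] at hx
    have : (sobolevWeight s x : ℂ) ≠ 0 := by
      rw [Complex.ofReal_ne_zero]
      exact (Real.rpow_pos_of_pos (by positivity) _).ne'
    simpa [this] using hx
  apply toL2_injective
  rw [map_zero]
  exact (map_eq_zero_iff _ (Lp.fourierTransformₗᵢ ℝ ℂ).injective).1 h2

/-- The norm `‖f‖² = ‖f‖²_{H^s} + ‖|x|^r f‖²_{L²}`, see `norm_sq_eq`. -/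
instance : NormedAddCommGroup (WeightedSobolev s r) :=
  NormedAddCommGroup.induced (WeightedSobolev s r) (WithLp 2 (L2R × L2R)) embed embed_injective

lemma norm_sq_eq (f : WeightedSobolev s r) :
    ‖f‖ ^ 2 =
      (∫ ξ : ℝ, (1 + (2 * Real.pi * ξ) ^ 2) ^ s * ‖(𝓕 f.toL2 : L2R) ξ‖ ^ 2) +
      ∫ x : ℝ, (|x| ^ r) ^ 2 * ‖f.toL2 x‖ ^ 2 := by
  have key : ∀ {g : ℝ → ℂ} (hg : MemLp g 2 volume), ‖hg.toLp g‖ ^ 2 = ∫ x, ‖g x‖ ^ 2 := by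
    intro g hg
    have h0 : ∫ x, ‖hg.toLp g x‖ ^ 2 = ∫ x, ‖g x‖ ^ 2 :=
      integral_congr_ae ((hg.coeFn_toLp).fun_comp (fun z ↦ ‖z‖ ^ 2))
    rw [← h0]
    have := L2.inner_def (𝕜 := ℂ) (hg.toLp g) (hg.toLp g)
    rw [inner_self_eq_norm_sq_to_K] at this
    simp_rw [inner_self_eq_norm_sq_to_K] at this
    have h2 : ((‖hg.toLp g‖ ^ 2 : ℝ) : ℂ) = ((∫ x, ‖hg.toLp g x‖ ^ 2 : ℝ) : ℂ) := by
      rw [← integral_complex_ofReal]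
      push_cast
      exact this
    exact_mod_cast h2
  have h : ‖f‖ ^ 2 = ‖f.memLp_sobolev.toLp _‖ ^ 2 + ‖f.memLp_weight.toLp _‖ ^ 2 :=
    WithLp.prod_norm_sq_eq_of_L2 (embed f)
  rw [h, key, key]
  congr 1
  · refine integral_congr_ae (Filter.Eventually.of_forall fun ξ ↦ ?_)
    have h0 : (0 : ℝ) ≤ 1 + (2 * Real.pi * ξ) ^ 2 := by positivity
    simp only [norm_mul, Complex.norm_real, mul_pow, Real.norm_eq_abs, sq_abs, sobolevWeight]
    rw [← Real.rpow_mul_natCast (by positivity)]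
    norm_num
  · refine integral_congr_ae (Filter.Eventually.of_forall fun x ↦ ?_)
    simp [mul_pow, sq_abs]

end WeightedSobolev

/-- `P` has degree `r`, and its coefficients of order `0, …, r` are positive. -/
def IsPositivePolynomial (r : ℕ) (P : Polynomial ℝ) : Prop :=
  P.natDegree = r ∧ ∀ k ≤ r, 0 < P.coeff k

/-- `E(t)` maps `φ` into the weighted space `H^s(ℝ) ∩ L²_r(ℝ)` for every `t`, with the bound
`‖E(t)φ‖ ≤ P(|t|) ‖φ‖`. -/
def GroupBound {s r : ℝ} (P : Polynomial ℝ) (φ : WeightedSobolev s r) : Prop :=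
  ∀ t : ℝ, ∃ ψ : WeightedSobolev s r, ψ.toL2 = group t φ.toL2 ∧ ‖ψ‖ ≤ P.eval |t| * ‖φ‖

/-- `t ↦ E(t)φ` belongs to `C([0,∞); H^s(ℝ) ∩ L²_r(ℝ))`. -/
def GroupContinuous {s r : ℝ} (φ : WeightedSobolev s r) : Prop :=
  ∃ u : C(Set.Ici (0 : ℝ), WeightedSobolev s r), ∀ t, (u t).toL2 = group t φ.toL2

/-- The derivatives `∂_ξ^j φ̂(0)` with `0 ≤ j ≤ r - 3` vanish. -/
def MomentsVanish (r : ℕ) (f : L2R) : Prop :=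
  ∀ j : ℕ, j + 3 ≤ r → iteratedDeriv j (𝓕 (f : ℝ → ℂ)) 0 = 0

end RBO

end

noncomputable section

namespace RBO

open Filter Topology Set
open scoped SchwartzMap

/-! ### The Fourier transform on `L¹ ∩ L²` -/

/-! On the Fourier side `E(t)` multiplies by `exp (t * symbolA ξ)`, and multiplication by `x` is
differentiation up to a constant. The symbol is unimodular, so the Sobolev part of the norm is
preserved up to constants; the question is whether `r` derivatives of the product of the symbol with
`φ̂` are in `L²`. The symbol is smooth on each closed half-line, with derivatives of order `j`
bounded by a multiple of `(1 + |t|) ^ j`. At the origin it is only `C¹`: its second derivative jumps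
by `16π²it` (`groupSymbol_jump`).

A product of a jumping function with `u` has a weak derivative without a Dirac mass exactly when `u`
vanishes at the jump. This is `Compatible`, and `isMulX_op` turns it into a commutator formula with
`x`. Iterating gives the Leibniz expansion of `x ^ r E(t)φ` (`isMulX_leibniz`), hence the bound
(`exists_toL2_eq_op`). A jump produced at the last derivative is harmless in `L²`, so the only
requirement is that `∂^j φ̂` vanish at `0` for `j + 3 ≤ r`. The same estimate for the difference of
two symbols gives continuity in time.

Conversely, if `x ^ (j + 2) E(t)φ` is integrable, its Fourier transform is continuous, so the jumps
in the Leibniz expansion must cancel (`sum_jump_eq_zero`). By strong induction on `j` the only jump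
left is a nonzero multiple of `t ∂^j φ̂(0)`, so one time `t ≠ 0` forces the conditions
(`fourier_moment_eq_zero`). -/

lemma continuous_fourier {f : ℝ → ℂ} (hf : Integrable f) : Continuous (𝓕 f) :=
  VectorFourier.fourierIntegral_continuous Real.continuous_fourierChar
    (by exact continuous_inner) hf

lemma norm_fourier_le (f : ℝ → ℂ) (ξ : ℝ) : ‖𝓕 f ξ‖ ≤ ∫ x, ‖f x‖ :=
  VectorFourier.norm_fourierIntegral_le_integral_norm _ _ _ _ _

/-- The `L²` Fourier transform is symmetric when tested against Schwartz functions. -/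
lemma integral_mul_fourier (ψ : 𝓢(ℝ, ℂ)) (f : L2R) :
    ∫ ξ, ψ ξ * (𝓕 f : L2R) ξ = ∫ x, 𝓕 (ψ : ℝ → ℂ) x * f x := by
  have h := congrArg (fun T : 𝓢'(ℝ, ℂ) ↦ T ψ) (Lp.fourier_toTemperedDistribution_eq f)
  simp only [TemperedDistribution.fourier_apply, Lp.toTemperedDistribution_apply,
    SchwartzMap.fourier_coe, smul_eq_mul] at h
  exact h.symm

lemma integral_mul_fourierInv (ψ : 𝓢(ℝ, ℂ)) (f : L2R) :
    ∫ ξ, ψ ξ * (𝓕⁻ f : L2R) ξ = ∫ x, 𝓕⁻ (ψ : ℝ → ℂ) x * f x := by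
  have h := congrArg (fun T : 𝓢'(ℝ, ℂ) ↦ T ψ) (Lp.fourierInv_toTemperedDistribution_eq f)
  simp only [TemperedDistribution.fourierInv_apply, Lp.toTemperedDistribution_apply,
    SchwartzMap.fourierInv_coe, smul_eq_mul] at h
  exact h.symm

/-- A real test function as a Schwartz function with complex values. -/
lemma exists_schwartz_of_testFunction {g : ℝ → ℝ} (hg : ContDiff ℝ (⊤ : ℕ∞) g)
    (hc : HasCompactSupport g) : ∃ ψ : 𝓢(ℝ, ℂ), ∀ x, ψ x = (g x : ℂ) := by
  have h1 : HasCompactSupport (Complex.ofRealCLM ∘ g) := hc.comp_left rfl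
  have h2 : ContDiff ℝ (⊤ : ℕ∞) (Complex.ofRealCLM ∘ g) := by fun_prop
  exact ⟨h1.toSchwartzMap h2, fun x ↦ rfl⟩

lemma integral_fourier_mul_eq {f g : ℝ → ℂ} (hf : Integrable f) (hg : Integrable g) :
    ∫ ξ, 𝓕 f ξ * g ξ = ∫ x, f x * 𝓕 g x := by
  have := VectorFourier.integral_fourierIntegral_smul_eq_flip (L := innerₗ ℝ)
    (f := f) (g := g) Real.continuous_fourierChar (by exact continuous_inner) hf hg
  rw [flip_innerₗ] at this
  exact this

lemma integral_fourierInv_mul_eq {f g : ℝ → ℂ} (hf : Integrable f) (hg : Integrable g) :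
    ∫ ξ, 𝓕⁻ f ξ * g ξ = ∫ x, f x * 𝓕⁻ g x := by
  have h := integral_fourier_mul_eq hf hg.comp_neg
  rw [← integral_neg_eq_self] at h
  simp only [Real.fourierInv_eq_fourier_neg]
  simp only [neg_neg] at h
  rw [h]
  refine integral_congr_ae (.of_forall fun x ↦ ?_)
  have := Real.fourierInv_eq_fourier_comp_neg g
  simp only [← Real.fourierInv_eq_fourier_neg, ← this]

/-- Both transforms have the same integral against every test function, one by duality for tempered
distributions and the other by Fubini. This supplies the continuous representative that gives values
at the origin a meaning. -/
lemma coeFn_fourier_of_integrable (f : L2R) (hf : Integrable f) :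
    (𝓕 f : L2R) =ᵐ[volume] 𝓕 (f : ℝ → ℂ) := by
  refine ae_eq_of_integral_contDiff_smul_eq ((Lp.memLp _).locallyIntegrable (by norm_num))
    (continuous_fourier hf).locallyIntegrable fun g hg hc ↦ ?_
  obtain ⟨ψ, hψ⟩ := exists_schwartz_of_testFunction hg hc
  have h1 := integral_mul_fourier ψ f
  rw [integral_fourier_mul_eq ψ.integrable hf] at h1
  simpa [hψ] using h1

lemma coeFn_fourierInv_of_integrable (f : L2R) (hf : Integrable f) :
    (𝓕⁻ f : L2R) =ᵐ[volume] 𝓕⁻ (f : ℝ → ℂ) := by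
  have hc : Continuous (𝓕⁻ (f : ℝ → ℂ)) := by
    rw [show 𝓕⁻ (f : ℝ → ℂ) = fun x ↦ 𝓕 (f : ℝ → ℂ) (-x) from
      funext fun x ↦ Real.fourierInv_eq_fourier_neg _ _]
    exact (continuous_fourier hf).comp continuous_neg
  refine ae_eq_of_integral_contDiff_smul_eq ((Lp.memLp _).locallyIntegrable (by norm_num))
    hc.locallyIntegrable fun g hg hc ↦ ?_
  obtain ⟨ψ, hψ⟩ := exists_schwartz_of_testFunction hg hc
  have h1 := integral_mul_fourierInv ψ f
  rw [integral_fourierInv_mul_eq ψ.integrable hf] at h1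
  simpa [hψ] using h1

/-- The inverse Fourier transform of the indicator function of `(a, b]`. -/
lemma fourierInv_indicator (a b : ℝ) (hab : a ≤ b) (x : ℝ) :
    𝓕⁻ ((Ioc a b).indicator fun _ ↦ (1 : ℂ)) x * (2 * Real.pi * Complex.I * x) =
      Complex.exp (2 * Real.pi * Complex.I * x * b) -
        Complex.exp (2 * Real.pi * Complex.I * x * a) := by
  have h : 𝓕⁻ ((Ioc a b).indicator fun _ ↦ (1 : ℂ)) x =
      ∫ ξ in a..b, Complex.exp (2 * Real.pi * Complex.I * x * ξ) := by
    rw [Real.fourierInv_eq', intervalIntegral.integral_of_le hab,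
      ← integral_indicator measurableSet_Ioc]
    refine integral_congr_ae (.of_forall fun ξ ↦ ?_)
    by_cases hξ : ξ ∈ Ioc a b
    · simp only [indicator_of_mem hξ, smul_eq_mul, mul_one]
      congr 1
      simp
      ring
    · simp [indicator_of_notMem hξ]
  rw [h]
  -- At `x = 0` both sides vanish; stating the identity without a quotient keeps this point
  -- included.
  by_cases hx : x = 0
  · simp [hx]
  have hc : (2 * Real.pi * Complex.I * x : ℂ) ≠ 0 := by
    simp [hx, Real.pi_ne_zero]
  rw [integral_exp_mul_complex hc, div_mul_cancel₀ _ hc]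

/-- The integral over an interval of an `L²` Fourier transform. -/
lemma intervalIntegral_fourier (h : L2R) (a b : ℝ) (hab : a ≤ b) :
    ∫ ξ in a..b, (𝓕 h : L2R) ξ =
      ∫ x, (starRingEnd ℂ) (𝓕⁻ ((Ioc a b).indicator fun _ ↦ (1 : ℂ)) x) * h x := by
  set w : L2R := indicatorConstLp 2 measurableSet_Ioc (by simp : volume (Ioc a b) ≠ ∞) (1 : ℂ)
    with hw
  have hwc : (w : ℝ → ℂ) =ᵐ[volume] (Ioc a b).indicator fun _ ↦ (1 : ℂ) :=
    indicatorConstLp_coeFn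
  have hwi : Integrable (w : ℝ → ℂ) := by
    rw [integrable_congr hwc]
    exact (integrable_indicator_iff measurableSet_Ioc).2
      (integrableOn_const (by simp) (by simp))
  have hinv : (𝓕⁻ w : L2R) =ᵐ[volume] 𝓕⁻ ((Ioc a b).indicator fun _ ↦ (1 : ℂ)) := by
    have e : 𝓕⁻ (w : ℝ → ℂ) = 𝓕⁻ ((Ioc a b).indicator fun _ ↦ (1 : ℂ)) := by
      ext x
      rw [Real.fourierInv_eq', Real.fourierInv_eq']
      refine integral_congr_ae ?_
      filter_upwards [hwc] with ξ hξ
      rw [hξ]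
    exact e ▸ coeFn_fourierInv_of_integrable w hwi
  -- Plancherel, with the indicator written as the transform of its inverse transform.
  have key : inner ℂ (𝓕 (𝓕⁻ w : L2R)) (𝓕 h) = inner ℂ (𝓕⁻ w : L2R) h := Lp.inner_fourier_eq _ _
  rw [fourier_fourierInv_eq, L2.inner_def, L2.inner_def] at key
  have e1 : ∫ ξ, inner ℂ (w ξ) ((𝓕 h : L2R) ξ) = ∫ ξ in a..b, (𝓕 h : L2R) ξ := by
    rw [intervalIntegral.integral_of_le hab, ← integral_indicator measurableSet_Ioc]
    refine integral_congr_ae ?_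
    filter_upwards [hwc] with ξ hξ
    rw [hξ]
    by_cases h' : ξ ∈ Ioc a b <;> simp [h']
  rw [← e1, key]
  refine integral_congr_ae ?_
  filter_upwards [hinv] with x hx
  rw [hx]
  simp [mul_comm]

/-! ### Multiplication by the variable -/

/-- `h` is the product of `g` with the variable. -/
def IsMulX (g h : L2R) : Prop := ∀ᵐ x : ℝ, h x = x * g x

lemma IsMulX.add {g h g' h' : L2R} (H : IsMulX g h) (H' : IsMulX g' h') :
    IsMulX (g + g') (h + h') := by
  filter_upwards [H, H', Lp.coeFn_add g g', Lp.coeFn_add h h'] with x h1 h2 h3 h4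
  rw [h3, h4, Pi.add_apply, Pi.add_apply, h1, h2, mul_add]

lemma IsMulX.smul {g h : L2R} (H : IsMulX g h) (c : ℂ) : IsMulX (c • g) (c • h) := by
  filter_upwards [H, Lp.coeFn_smul c g, Lp.coeFn_smul c h] with x h1 h3 h4
  rw [h3, h4, Pi.smul_apply, Pi.smul_apply, h1, smul_eq_mul, smul_eq_mul, mul_left_comm]

lemma IsMulX.sum {ι : Type*} (s : Finset ι) {g h : ι → L2R} (H : ∀ i ∈ s, IsMulX (g i) (h i)) :
    IsMulX (∑ i ∈ s, g i) (∑ i ∈ s, h i) := by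
  classical
  induction s using Finset.induction_on with
  | empty =>
    simp [IsMulX]
  | insert a s ha ih =>
    rw [Finset.sum_insert ha, Finset.sum_insert ha]
    exact (H a (by simp)).add (ih fun i hi ↦ H i (by simp [hi]))

lemma memLp_inv_one_add_abs : MemLp (fun x : ℝ ↦ ((1 + |x|)⁻¹ : ℝ)) 2 volume := by
  have hm : AEStronglyMeasurable (fun x : ℝ ↦ ((1 + |x|)⁻¹ : ℝ)) volume :=
    Measurable.aestronglyMeasurable (by fun_prop)
  rw [memLp_two_iff_integrable_sq hm]
  refine integrable_inv_one_add_sq.mono (hm.pow 2) (.of_forall fun x ↦ ?_)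
  rw [Real.norm_of_nonneg (by positivity), Real.norm_of_nonneg (by positivity), inv_pow]
  gcongr
  nlinarith [abs_nonneg x, sq_abs x]

/-- Cauchy–Schwarz: `‖g‖` is the product of `(1 + |x|)⁻¹` and `‖g‖ + ‖x g‖`, both in `L²`. -/
lemma IsMulX.integrable {g h : L2R} (H : IsMulX g h) : Integrable (g : ℝ → ℂ) := by
  have h1 : MemLp (fun x ↦ ‖g x‖ + ‖h x‖) 2 volume := (Lp.memLp g).norm.add (Lp.memLp h).norm
  have h2 := memLp_inv_one_add_abs.integrable_mul h1
  refine h2.mono (Lp.memLp g).1 ?_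
  filter_upwards [H] with x hx
  rw [Pi.mul_apply, hx, Real.norm_of_nonneg (by positivity), norm_mul, Complex.norm_real,
    Real.norm_eq_abs]
  have : 0 < 1 + |x| := by positivity
  rw [show ‖g x‖ + |x| * ‖g x‖ = (1 + |x|) * ‖g x‖ by ring, inv_mul_cancel_left₀ this.ne']

/-- If `g` and `x g` are in `L²`, the Fourier transform of `g` is a primitive of that of
`-2πi x g`. -/
lemma IsMulX.fourier_sub {g h : L2R} (H : IsMulX g h) (a b : ℝ) :
    𝓕 (g : ℝ → ℂ) b - 𝓕 (g : ℝ → ℂ) a =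
      ∫ ξ in a..b, (-(2 * Real.pi * Complex.I)) * (𝓕 h : L2R) ξ := by
  wlog hab : a ≤ b generalizing a b
  · rw [intervalIntegral.integral_symm, ← this b a (le_of_not_ge hab), neg_sub]
  have hg := H.integrable
  have hi : ∀ c : ℝ,
      Integrable fun x : ℝ ↦ Complex.exp (-(2 * Real.pi * Complex.I * x * c)) * g x := by
    intro c
    refine hg.bdd_mul (c := 1) (by fun_prop) (.of_forall fun x ↦ ?_)
    rw [show -(2 * Real.pi * Complex.I * x * c : ℂ) = ((-(2 * Real.pi * x * c) : ℝ) : ℂ) *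
      Complex.I by push_cast; ring, Complex.norm_exp_ofReal_mul_I]
  have hF : ∀ c : ℝ, 𝓕 (g : ℝ → ℂ) c =
      ∫ x : ℝ, Complex.exp (-(2 * Real.pi * Complex.I * x * c)) * g x := by
    intro c
    rw [Real.fourier_real_eq_integral_exp_smul]
    refine integral_congr_ae (.of_forall fun x ↦ ?_)
    simp only [smul_eq_mul]
    congr 2
    push_cast
    ring
  rw [intervalIntegral.integral_const_mul, intervalIntegral_fourier h a b hab, hF, hF,
    ← integral_sub (hi _) (hi _), ← integral_const_mul]
  refine integral_congr_ae ?_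
  filter_upwards [H] with x hx
  -- The conjugated identity trades the factor `x` coming from `h` for the difference of the two
  -- exponentials.
  have := congrArg (starRingEnd ℂ) (fourierInv_indicator a b hab x)
  simp only [map_mul, map_sub, ← Complex.exp_conj, Complex.conj_I, Complex.conj_ofReal,
    map_ofNat] at this
  rw [hx, ← sub_mul]
  have e : ∀ c : ℝ, -(2 * Real.pi * Complex.I * x * c : ℂ) =
    2 * Real.pi * -Complex.I * x * c := fun c ↦ by ring
  rw [e, e, ← this]
  ring

/-! ### Products with absolutely continuous functions -/

/-- The increments are dominated by those of the primitive of `‖w‖`, which reduces the complex case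
to the real one. -/
lemma absolutelyContinuousOnInterval_integral {w : ℝ → ℂ} {a b : ℝ}
    (hw : IntervalIntegrable w volume a b) :
    AbsolutelyContinuousOnInterval (fun x ↦ ∫ t in a..x, w t) a b := by
  have h1 := hw.norm.absolutelyContinuousOnInterval_intervalIntegral (c := a) (by simp)
  refine squeeze_zero' (.of_forall fun E ↦ Finset.sum_nonneg fun i _ ↦ dist_nonneg) ?_ h1
  rw [eventually_inf_principal]
  refine .of_forall fun E hE ↦ Finset.sum_le_sum fun i hi ↦ ?_
  have hsub : ∀ c ∈ uIcc a b, IntervalIntegrable w volume a c := fun c hc ↦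
    hw.mono_set (uIcc_subset_uIcc (by simp) hc)
  have h2 := hsub _ (hE.1 i hi).1
  have h3 := hsub _ (hE.1 i hi).2
  rw [dist_comm, dist_comm (∫ t in a..(E.2 i).1, ‖w t‖), dist_eq_norm, dist_eq_norm,
    intervalIntegral.integral_interval_sub_left h3 h2,
    intervalIntegral.integral_interval_sub_left h3.norm h2.norm]
  exact intervalIntegral.norm_integral_le_abs_integral_norm

/-- The product rule for a continuously differentiable function and a primitive. -/
lemma mul_sub_mul_eq_integral {m m' u w : ℝ → ℂ} {a b : ℝ}
    (hm : ∀ x ∈ uIcc a b, HasDerivAt m (m' x) x) (hm' : ContinuousOn m' (uIcc a b))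
    (hw : IntervalIntegrable w volume a b) (hu : ∀ x ∈ uIcc a b, u x - u a = ∫ t in a..x, w t) :
    IntervalIntegrable (fun x ↦ m' x * u x + m x * w x) volume a b ∧
      m b * u b - m a * u a = ∫ x in a..b, (m' x * u x + m x * w x) := by
  have hu' : ∀ x ∈ uIcc a b, u x = u a + ∫ t in a..x, w t := fun x hx ↦ by rw [← hu x hx]; ring
  have hW := absolutelyContinuousOnInterval_integral hw
  set U : ℝ → ℂ := fun x ↦ u a + ∫ t in a..x, w t with hU
  have hUac : AbsolutelyContinuousOnInterval U a b := by
    refine (LipschitzOnWith.absolutelyContinuousOnInterval (K := 0) ?_).fun_add hW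
    exact (LipschitzWith.const (u a)).lipschitzOnWith
  have hmc : ContinuousOn m (uIcc a b) := fun x hx ↦ (hm x hx).continuousAt.continuousWithinAt
  obtain ⟨C, hC⟩ := isCompact_uIcc.exists_bound_of_continuousOn hm'
  have hmac : AbsolutelyContinuousOnInterval m a b := by
    refine LipschitzOnWith.absolutelyContinuousOnInterval (K := C.toNNReal) ?_
    refine Convex.lipschitzOnWith_of_nnnorm_hasDerivWithin_le (convex_uIcc a b)
      (fun x hx ↦ (hm x hx).hasDerivWithinAt) fun x hx ↦ ?_
    rw [← norm_toNNReal]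
    exact Real.toNNReal_le_toNNReal (hC x hx)
  have hint : IntervalIntegrable (fun x ↦ m' x * U x + m x * w x) volume a b :=
    (hm'.mul hUac.continuousOn).intervalIntegrable.add (hw.continuousOn_mul hmc)
  have hcongr : EqOn (fun x ↦ m' x * U x + m x * w x) (fun x ↦ m' x * u x + m x * w x)
      (uIcc a b) := fun x hx ↦ by simp only [hU, ← hu' x hx]
  refine ⟨hint.congr fun x hx ↦ hcongr (uIoc_subset_uIcc hx), ?_⟩
  -- The product minus its candidate primitive is absolutely continuous with zero derivative almost
  -- everywhere, hence constant.
  have hac := (hmac.fun_smul hUac).fun_sub (absolutelyContinuousOnInterval_integral hint)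
  have hd : ∀ᵐ x, x ∈ uIcc a b →
      HasDerivAt (fun x ↦ m x • U x - ∫ t in a..x, (m' t * U t + m t * w t)) 0 x := by
    filter_upwards [hw.ae_hasDerivAt_integral, hint.ae_hasDerivAt_integral] with x h1 h2 hx
    have h3 : HasDerivAt U (w x) x := (h1 hx a (by simp)).const_add (u a)
    have := ((hm x hx).mul h3).sub (h2 hx a (by simp))
    rwa [sub_self] at this
  obtain ⟨K, hK⟩ := hac.const_of_ae_hasDerivAt_zero hd
  have ha := hK a (by simp)
  have hb := hK b (by simp)
  have e1 : U a = u a := (hu' a (by simp)).symm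
  have e2 : U b = u b := (hu' b (by simp)).symm
  rw [intervalIntegral.integral_same, sub_zero, smul_eq_mul, e1] at ha
  rw [smul_eq_mul, e2, ← ha] at hb
  rw [← intervalIntegral.integral_congr hcongr, ← sub_eq_zero, sub_right_comm, hb, sub_self]

/-! ### Recognizing multiplication by the variable on the Fourier side -/

lemma intervalIntegrable_coeFn (h : L2R) (a b : ℝ) : IntervalIntegrable (h : ℝ → ℂ) volume a b :=
  (((Lp.memLp h).locallyIntegrable (by norm_num)).integrableOn_isCompact
    isCompact_uIcc).intervalIntegrable

/-- Integrate by parts on `[-n, n]` and let `n → ∞`; the boundary terms vanish because `ψ` decays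
and `u` is bounded. -/
lemma integral_deriv_mul_add_eq_zero {u w : ℝ → ℂ} {C : ℝ} (hub : ∀ ξ, ‖u ξ‖ ≤ C)
    (hw : MemLp w 2 volume) (hd : ∀ a b, u b - u a = ∫ ξ in a..b, w ξ) (ψ : 𝓢(ℝ, ℂ)) :
    ∫ ξ, deriv ψ ξ * u ξ = - ∫ ξ, ψ ξ * w ξ := by
  have hwi : ∀ a b, IntervalIntegrable w volume a b := fun a b ↦
    ((hw.locallyIntegrable (by norm_num)).integrableOn_isCompact isCompact_uIcc).intervalIntegrable
  have huc : Continuous u := by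
    have : u = fun x ↦ u 0 + ∫ ξ in (0 : ℝ)..x, w ξ := funext fun x ↦ by rw [← hd]; ring
    rw [this]
    exact continuous_const.add (intervalIntegral.continuous_primitive hwi 0)
  have hd1 : Integrable fun ξ ↦ deriv ψ ξ * u ξ := by
    have : Integrable (deriv ψ) := (SchwartzMap.derivCLM ℂ ℂ ψ).integrable
    exact this.mul_bdd huc.aestronglyMeasurable (.of_forall hub)
  have hd2 : Integrable fun ξ ↦ ψ ξ * w ξ := (ψ.memLp 2 volume).integrable_mul hw
  have key : ∀ n : ℕ, ψ n * u n - ψ (-n) * u (-n) =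
      ∫ ξ in (-n : ℝ)..n, (deriv ψ ξ * u ξ + ψ ξ * w ξ) := fun n ↦
    (mul_sub_mul_eq_integral (fun x _ ↦ (ψ.differentiable x).hasDerivAt)
      (SchwartzMap.derivCLM ℂ ℂ ψ).continuous.continuousOn (hwi _ _) fun x _ ↦ hd _ x).2
  have hn : Tendsto (fun n : ℕ ↦ (n : ℝ)) atTop atTop := tendsto_natCast_atTop_atTop
  have lim1 := intervalIntegral_tendsto_integral (hd1.add hd2)
    (tendsto_neg_atTop_atBot.comp hn) hn
  have hz : ∀ v : ℕ → ℝ, Tendsto v atTop (cocompact ℝ) →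
      Tendsto (fun n ↦ ψ (v n) * u (v n)) atTop (𝓝 0) := by
    intro v hv
    have h0 := (ψ.tendsto_cocompact.comp hv).norm.mul_const C
    rw [norm_zero, zero_mul] at h0
    refine squeeze_zero_norm (fun n ↦ ?_) h0
    rw [norm_mul]
    exact mul_le_mul_of_nonneg_left (hub _) (norm_nonneg _)
  have lim2 := (hz _ (hn.mono_right atTop_le_cocompact)).sub
    (hz _ ((tendsto_neg_atTop_atBot.comp hn).mono_right atBot_le_cocompact))
  have := tendsto_nhds_unique lim1 (lim2.congr key)
  rw [integral_add' hd1 hd2, sub_zero] at this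
  exact eq_neg_of_add_eq_zero_left this

/-- If the Fourier transform of `g` has a bounded version which is a primitive of
`-2πi 𝓕 h`, then `h = x g`. -/
lemma isMulX_of_fourier_sub {g h : L2R} {u : ℝ → ℂ} {C : ℝ} (hu : (𝓕 g : L2R) =ᵐ[volume] u)
    (hub : ∀ ξ, ‖u ξ‖ ≤ C)
    (hd : ∀ a b, u b - u a = ∫ ξ in a..b, (-(2 * Real.pi * Complex.I)) * (𝓕 h : L2R) ξ) :
    IsMulX g h := by
  have hc : (2 * Real.pi * Complex.I : ℂ) ≠ 0 := by simp [Real.pi_ne_zero]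
  have key : ∀ Φ : 𝓢(ℝ, ℂ), ∫ x : ℝ, Φ x * (x * g x) = ∫ x, Φ x * h x := by
    intro Φ
    -- Testing on the Fourier side with `𝓕⁻ Φ` makes the transform of `deriv ψ` equal to `2πi x Φ`,
    -- so the weak derivative becomes multiplication by `x`.
    set ψ : 𝓢(ℝ, ℂ) := 𝓕⁻ Φ with hψ
    have hF : 𝓕 (ψ : ℝ → ℂ) = Φ := by
      rw [← SchwartzMap.fourier_coe, hψ, fourier_fourierInv_eq]
    have hF' : 𝓕 (deriv ψ : ℝ → ℂ) = fun x : ℝ ↦ (2 * Real.pi * Complex.I * x) * Φ x := by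
      have := Real.fourier_deriv ψ.integrable ψ.differentiable
        (SchwartzMap.derivCLM ℂ ℂ ψ).integrable
      rw [this, hF]
      rfl
    have h1 := integral_mul_fourier (SchwartzMap.derivCLM ℂ ℂ ψ) g
    have h2 := integral_mul_fourier ψ h
    have h3 := integral_deriv_mul_add_eq_zero hub ((Lp.memLp (𝓕 h : L2R)).const_mul _) hd ψ
    have h4 : ∫ ξ, deriv ψ ξ * u ξ = ∫ ξ, deriv ψ ξ * (𝓕 g : L2R) ξ :=
      integral_congr_ae (by filter_upwards [hu] with ξ hξ; rw [hξ])
    have h5 : ∫ x, 𝓕 (deriv ψ : ℝ → ℂ) x * g x =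
        (2 * Real.pi * Complex.I) * ∫ x : ℝ, Φ x * (x * g x) := by
      rw [hF', ← integral_const_mul]
      exact integral_congr_ae (.of_forall fun x ↦ by ring)
    have h6 : ∫ ξ, ψ ξ * (-(2 * Real.pi * Complex.I) * (𝓕 h : L2R) ξ) =
        -(2 * Real.pi * Complex.I) * ∫ x, Φ x * h x := by
      rw [← hF, ← h2, ← integral_const_mul]
      exact integral_congr_ae (.of_forall fun x ↦ by ring)
    have h7 : (2 * Real.pi * Complex.I) * ∫ x : ℝ, Φ x * (x * g x) =
        (2 * Real.pi * Complex.I) * ∫ x, Φ x * h x := by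
      rw [← h5]
      refine h1.symm.trans (h4.symm.trans (h3.trans ?_))
      rw [h6]
      ring
    exact mul_left_cancel₀ hc h7
  have hloc : LocallyIntegrable (fun x : ℝ ↦ (x : ℂ) * g x) volume :=
    ((Lp.memLp g).locallyIntegrable (by norm_num)).continuous_mul (by fun_prop)
  refine ae_eq_of_integral_contDiff_smul_eq ((Lp.memLp _).locallyIntegrable (by norm_num)) hloc
    fun φ hφ hφc ↦ ?_
  obtain ⟨ψ, hψ⟩ := exists_schwartz_of_testFunction hφ hφc
  have := key ψ
  simp only [hψ] at this
  simpa using this.symm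

/-! ### Multipliers with piecewise smooth symbols -/

lemma coeFn_fourier_fourierMultiplier (m : Lp ℂ ∞ (volume : Measure ℝ)) (f : L2R) :
    (𝓕 (fourierMultiplier m f) : L2R) =ᵐ[volume] fun ξ ↦ m ξ * (𝓕 f : L2R) ξ := by
  have h : (𝓕 (fourierMultiplier m f) : L2R) =
      (ContinuousLinearMap.mul ℂ ℂ).holder 2 m (𝓕 f : L2R) :=
    (Lp.fourierTransformₗᵢ ℝ ℂ).apply_symm_apply _
  rw [h]
  exact ContinuousLinearMap.coeFn_holder _ _ _

/-- Two towers of functions, bounded on the two half-lines together with all their derivatives. -/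
structure PiecewiseSymbol where
  /-- The derivatives on `[0, ∞)`. -/
  pos : ℕ → ℝ → ℂ
  /-- The derivatives on `(-∞, 0]`. -/
  neg : ℕ → ℝ → ℂ
  hasDerivAt_pos : ∀ j ξ, 0 ≤ ξ → HasDerivAt (pos j) (pos (j + 1) ξ) ξ
  hasDerivAt_neg : ∀ j ξ, ξ ≤ 0 → HasDerivAt (neg j) (neg (j + 1) ξ) ξ
  bounded : ∀ j, ∃ C, (∀ ξ, 0 ≤ ξ → ‖pos j ξ‖ ≤ C) ∧ ∀ ξ, ξ ≤ 0 → ‖neg j ξ‖ ≤ C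

namespace PiecewiseSymbol

variable (M : PiecewiseSymbol)

/-- The derivative of order `j`, away from the origin. -/
def symbol (j : ℕ) (ξ : ℝ) : ℂ := if 0 ≤ ξ then M.pos j ξ else M.neg j ξ

lemma symbol_of_nonneg (j : ℕ) {ξ : ℝ} (h : 0 ≤ ξ) : M.symbol j ξ = M.pos j ξ := if_pos h

lemma symbol_of_neg (j : ℕ) {ξ : ℝ} (h : ξ < 0) : M.symbol j ξ = M.neg j ξ := if_neg h.not_ge

lemma continuousOn_pos (j : ℕ) : ContinuousOn (M.pos j) (Ici 0) := fun ξ hξ ↦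
  (M.hasDerivAt_pos j ξ hξ).continuousAt.continuousWithinAt

lemma continuousOn_neg (j : ℕ) : ContinuousOn (M.neg j) (Iic 0) := fun ξ hξ ↦
  (M.hasDerivAt_neg j ξ hξ).continuousAt.continuousWithinAt

lemma exists_norm_symbol_le (j : ℕ) : ∃ C, ∀ ξ, ‖M.symbol j ξ‖ ≤ C := by
  obtain ⟨C, h1, h2⟩ := M.bounded j
  refine ⟨C, fun ξ ↦ ?_⟩
  rcases le_or_gt 0 ξ with h | h
  · rw [M.symbol_of_nonneg j h]; exact h1 ξ h
  · rw [M.symbol_of_neg j h]; exact h2 ξ h.le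

lemma measurable_symbol (j : ℕ) : Measurable (M.symbol j) := by
  classical
  have : M.symbol j = (Ici (0 : ℝ)).piecewise (M.pos j) (M.neg j) := by
    ext ξ
    simp [symbol, piecewise]
  rw [this]
  refine (M.continuousOn_pos j).measurable_piecewise ((M.continuousOn_neg j).mono fun x hx ↦ ?_)
    measurableSet_Ici
  simp only [mem_compl_iff, mem_Ici, not_le] at hx
  exact hx.le

lemma memLp_symbol (j : ℕ) : MemLp (M.symbol j) ∞ (volume : Measure ℝ) := by
  obtain ⟨C, hC⟩ := M.exists_norm_symbol_le j
  exact memLp_top_of_bound (M.measurable_symbol j).aestronglyMeasurable C (.of_forall hC)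

/-- The Fourier multiplier whose symbol is the derivative of order `j`. -/
def op (j : ℕ) : L2R →L[ℂ] L2R := fourierMultiplier ((M.memLp_symbol j).toLp _)

lemma coeFn_fourier_op (j : ℕ) (f : L2R) :
    (𝓕 (M.op j f) : L2R) =ᵐ[volume] fun ξ ↦ M.symbol j ξ * (𝓕 f : L2R) ξ := by
  filter_upwards [coeFn_fourier_fourierMultiplier ((M.memLp_symbol j).toLp _) f,
    (M.memLp_symbol j).coeFn_toLp] with ξ h1 h2
  rw [op, h1, h2]

lemma norm_op_le {j : ℕ} {c : ℝ} (hc : ∀ ξ, ‖M.symbol j ξ‖ ≤ c) (f : L2R) :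
    ‖M.op j f‖ ≤ c * ‖f‖ := by
  rw [← Lp.norm_fourier_eq f, ← Lp.norm_fourier_eq (M.op j f)]
  refine Lp.norm_le_mul_norm_of_ae_le_mul ?_
  filter_upwards [M.coeFn_fourier_op j f] with ξ hξ
  rw [hξ, norm_mul]
  exact mul_le_mul_of_nonneg_right (hc ξ) (norm_nonneg _)

/-- The two versions of the derivative of order `j` agree at the origin, or the Fourier transform
of `f` vanishes there. -/
def Compatible (j : ℕ) (f : L2R) : Prop :=
  M.pos j 0 * 𝓕 (f : ℝ → ℂ) 0 = M.neg j 0 * 𝓕 (f : ℝ → ℂ) 0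

/-- The interval starts at the origin, so it stays in one half-line, where the ordinary product rule
applies. -/
lemma symbol_mul_fourier_sub {g h : L2R} (H : IsMulX g h) {j : ℕ} (hc : M.Compatible j g)
    (b : ℝ) :
    IntervalIntegrable (fun ξ ↦ M.symbol (j + 1) ξ * 𝓕 (g : ℝ → ℂ) ξ +
        M.symbol j ξ * (-(2 * Real.pi * Complex.I) * (𝓕 h : L2R) ξ)) volume 0 b ∧
      M.symbol j b * 𝓕 (g : ℝ → ℂ) b - M.symbol j 0 * 𝓕 (g : ℝ → ℂ) 0 =
      ∫ ξ in (0 : ℝ)..b, (M.symbol (j + 1) ξ * 𝓕 (g : ℝ → ℂ) ξ +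
        M.symbol j ξ * (-(2 * Real.pi * Complex.I) * (𝓕 h : L2R) ξ)) := by
  have hi : IntervalIntegrable (fun ξ ↦ -(2 * Real.pi * Complex.I) * (𝓕 h : L2R) ξ) volume 0 b :=
    (intervalIntegrable_coeFn _ 0 b).const_mul _
  rcases le_or_gt 0 b with hb | hb
  · have hs : uIcc 0 b ⊆ Ici 0 := by rw [uIcc_of_le hb]; exact Icc_subset_Ici_self
    obtain ⟨h1, h2⟩ := mul_sub_mul_eq_integral (fun x hx ↦ M.hasDerivAt_pos j x (hs hx))
      ((M.continuousOn_pos (j + 1)).mono hs) hi (fun x _ ↦ H.fourier_sub 0 x)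
    have e : EqOn (fun x ↦ M.pos (j + 1) x * 𝓕 (g : ℝ → ℂ) x +
          M.pos j x * (-(2 * Real.pi * Complex.I) * (𝓕 h : L2R) x))
        (fun ξ ↦ M.symbol (j + 1) ξ * 𝓕 (g : ℝ → ℂ) ξ +
          M.symbol j ξ * (-(2 * Real.pi * Complex.I) * (𝓕 h : L2R) ξ)) (uIcc 0 b) := by
      intro x hx
      simp only [M.symbol_of_nonneg _ (hs hx)]
    refine ⟨h1.congr fun x hx ↦ e (uIoc_subset_uIcc hx), ?_⟩
    rw [← intervalIntegral.integral_congr e, ← h2, M.symbol_of_nonneg j hb,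
      M.symbol_of_nonneg j le_rfl]
  · have hs : uIcc 0 b ⊆ Iic 0 := by rw [uIcc_of_ge hb.le]; exact Icc_subset_Iic_self
    obtain ⟨h1, h2⟩ := mul_sub_mul_eq_integral (fun x hx ↦ M.hasDerivAt_neg j x (hs hx))
      ((M.continuousOn_neg (j + 1)).mono hs) hi (fun x _ ↦ H.fourier_sub 0 x)
    have e : ∀ᵐ x : ℝ, x ∈ uIoc 0 b → M.neg (j + 1) x * 𝓕 (g : ℝ → ℂ) x +
          M.neg j x * (-(2 * Real.pi * Complex.I) * (𝓕 h : L2R) x) =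
        M.symbol (j + 1) x * 𝓕 (g : ℝ → ℂ) x +
          M.symbol j x * (-(2 * Real.pi * Complex.I) * (𝓕 h : L2R) x) := by
      filter_upwards [Measure.ae_ne volume (0 : ℝ)] with x hx hx'
      have : x < 0 := lt_of_le_of_ne (hs (uIoc_subset_uIcc hx')) hx
      simp only [M.symbol_of_neg _ this]
    refine ⟨h1.congr_ae ?_, ?_⟩
    · exact (ae_restrict_iff' measurableSet_uIoc).2 e
    -- By convention `symbol` takes the value of `pos` at the origin; `hc` exchanges it for that of
    -- `neg`.
    · rw [← intervalIntegral.integral_congr_ae e, ← h2, M.symbol_of_neg j hb,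
        M.symbol_of_nonneg j le_rfl, hc]

/-- The commutator of a multiplier with multiplication by the variable. -/
lemma isMulX_op {g h : L2R} (H : IsMulX g h) {j : ℕ} (hc : M.Compatible j g) :
    IsMulX (M.op j g) (M.op j h + (Complex.I / (2 * Real.pi)) • M.op (j + 1) g) := by
  obtain ⟨C, hC⟩ := M.exists_norm_symbol_le j
  have hg := coeFn_fourier_of_integrable g H.integrable
  have hu : (𝓕 (M.op j g) : L2R) =ᵐ[volume] fun ξ ↦ M.symbol j ξ * 𝓕 (g : ℝ → ℂ) ξ := by
    filter_upwards [M.coeFn_fourier_op j g, hg] with ξ h1 h2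
    rw [h1, h2]
  refine isMulX_of_fourier_sub (C := C * ∫ x, ‖g x‖) hu (fun ξ ↦ ?_) fun a b ↦ ?_
  · rw [norm_mul]
    exact mul_le_mul (hC ξ) (norm_fourier_le _ _) (norm_nonneg _) ((norm_nonneg _).trans (hC 0))
  · obtain ⟨ha1, ha2⟩ := M.symbol_mul_fourier_sub H hc a
    obtain ⟨hb1, hb2⟩ := M.symbol_mul_fourier_sub H hc b
    -- Passing through the value at `0` covers intervals that cross the origin.
    rw [← sub_sub_sub_cancel_right _ _ (M.symbol j 0 * 𝓕 (g : ℝ → ℂ) 0), ha2, hb2,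
      intervalIntegral.integral_interval_sub_left hb1 ha1]
    refine intervalIntegral.integral_congr_ae ?_
    rw [FourierTransform.fourier_add, FourierTransform.fourier_smul]
    filter_upwards [M.coeFn_fourier_op j h, M.coeFn_fourier_op (j + 1) g, hg,
      Lp.coeFn_add (𝓕 (M.op j h) : L2R) ((Complex.I / (2 * Real.pi)) • 𝓕 (M.op (j + 1) g)),
      Lp.coeFn_smul (Complex.I / (2 * Real.pi) : ℂ) (𝓕 (M.op (j + 1) g) : L2R)]
      with ξ h1 h2 h3 h4 h5 _
    rw [h4, Pi.add_apply, h5, Pi.smul_apply, h1, h2, h3, smul_eq_mul]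
    have hpi : (Real.pi : ℂ) ≠ 0 := by simp [Real.pi_ne_zero]
    -- The constant `I / (2π)` is the inverse of `-2πI`.
    field_simp
    linear_combination (M.symbol (j + 1) ξ * 𝓕 (g : ℝ → ℂ) ξ) * Complex.I_sq

/-- The Leibniz expansion of `x ^ k` times a multiplier, where `f i` stands for `x ^ i f`. -/
def leibniz (f : ℕ → L2R) (k : ℕ) : L2R :=
  ∑ p ∈ Finset.HasAntidiagonal.antidiagonal k,
    k.choose p.1 • ((Complex.I / (2 * Real.pi)) ^ p.1 • M.op p.1 (f p.2))

lemma leibniz_zero (f : ℕ → L2R) : M.leibniz f 0 = M.op 0 (f 0) := by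
  simp [leibniz]

/-- By `isMulX_op`, multiplication by `x` sends the term of index `(i, j)` to those of index `(i, j
+ 1)` and `(i + 1, j)`; Pascal's rule collects them. -/
lemma isMulX_leibniz {f : ℕ → L2R} {k : ℕ} (hf : ∀ i ≤ k, IsMulX (f i) (f (i + 1)))
    (hc : ∀ i j, i + j = k → M.Compatible i (f j)) :
    IsMulX (M.leibniz f k) (M.leibniz f (k + 1)) := by
  have h := Finset.sum_antidiagonal_choose_succ_nsmul
    (fun i j ↦ (Complex.I / (2 * Real.pi) : ℂ) ^ i • M.op i (f j)) k
  rw [leibniz, leibniz, h, ← Finset.sum_add_distrib]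
  refine IsMulX.sum _ fun p hp ↦ ?_
  have hp' := Finset.HasAntidiagonal.mem_antidiagonal.1 hp
  rw [← Nat.choose_symm_of_eq_add hp'.symm, ← nsmul_add, ← Nat.cast_smul_eq_nsmul ℂ,
    ← Nat.cast_smul_eq_nsmul ℂ]
  refine IsMulX.smul ?_ _
  rw [pow_succ, mul_smul, ← smul_add]
  exact (M.isMulX_op (hf _ (by omega)) (hc _ _ hp')).smul _

lemma norm_leibniz_le {f : ℕ → L2R} {k : ℕ} {c : ℕ → ℝ} {B : ℝ}
    (hc : ∀ j ≤ k, ∀ ξ, ‖M.symbol j ξ‖ ≤ c j) (hB : ∀ i ≤ k, ‖f i‖ ≤ B) :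
    ‖M.leibniz f k‖ ≤ (∑ p ∈ Finset.HasAntidiagonal.antidiagonal k, k.choose p.1 * c p.1) * B := by
  rw [leibniz, Finset.sum_mul]
  refine norm_sum_le_of_le _ fun p hp ↦ ?_
  have hp' := Finset.HasAntidiagonal.mem_antidiagonal.1 hp
  have h0 : 0 ≤ c p.1 := (norm_nonneg _).trans (hc p.1 (by omega) 0)
  have hκ : ‖(Complex.I / (2 * Real.pi) : ℂ) ^ p.1‖ ≤ 1 := by
    rw [norm_pow]
    refine pow_le_one₀ (norm_nonneg _) ?_
    rw [norm_div, Complex.norm_I, norm_mul, Complex.norm_real, Real.norm_of_nonneg Real.pi_pos.le,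
      Complex.norm_ofNat]
    exact div_le_one_of_le₀ (by linarith [Real.pi_gt_three]) (by positivity)
  rw [← Nat.cast_smul_eq_nsmul ℝ, norm_smul, norm_smul, Real.norm_natCast, mul_assoc]
  refine mul_le_mul_of_nonneg_left ?_ (Nat.cast_nonneg _)
  calc _ ≤ 1 * (c p.1 * B) := by
        refine mul_le_mul hκ ?_ (norm_nonneg _) zero_le_one
        exact (M.norm_op_le (hc _ (by omega)) _).trans
          (mul_le_mul_of_nonneg_left (hB _ (by omega)) h0)
    _ = _ := one_mul _

end PiecewiseSymbol

/-! ### The symbol of the group -/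

/-- The partial sums of the operator exponential act as multiplication by those of the scalar
exponential. They converge in `L²`, hence almost everywhere along a subsequence, and the pointwise
limit identifies the result. -/
lemma coeFn_fourier_group (t : ℝ) (f : L2R) :
    (𝓕 (group t f) : L2R) =ᵐ[volume]
      fun ξ ↦ Complex.exp (t * symbolA ξ) * (𝓕 f : L2R) ξ := by
  have hgen : ∀ f : L2R, (𝓕 (generator f) : L2R) =ᵐ[volume]
      fun ξ ↦ symbolA ξ * (𝓕 f : L2R) ξ := fun f ↦ by
    filter_upwards [coeFn_fourier_fourierMultiplier (memLp_symbolA.toLp symbolA) f,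
      memLp_symbolA.coeFn_toLp] with ξ h1 h2
    rw [generator, h1, h2]
  have hpow : ∀ n : ℕ, (𝓕 ((((t : ℂ) • generator) ^ n) f) : L2R) =ᵐ[volume]
      fun ξ ↦ (t * symbolA ξ) ^ n * (𝓕 f : L2R) ξ := by
    intro n
    induction n with
    | zero => simp
    | succ n ih =>
      rw [pow_succ', mul_apply_eq_comp, smul_apply,
        FourierTransform.fourier_smul]
      filter_upwards [ih, hgen ((((t : ℂ) • generator) ^ n) f),
        Lp.coeFn_smul (t : ℂ) (𝓕 (generator ((((t : ℂ) • generator) ^ n) f)) : L2R)]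
        with ξ h1 h2 h3
      rw [h3, Pi.smul_apply, h2, h1, smul_eq_mul]
      ring
  have hpart : ∀ N : ℕ,
      (𝓕 ((∑ n ∈ Finset.range N, ((n.factorial : ℂ)⁻¹) • ((t : ℂ) • generator) ^ n) f) : L2R)
      =ᵐ[volume] fun ξ ↦ (∑ n ∈ Finset.range N, (t * symbolA ξ) ^ n / n.factorial) *
        (𝓕 f : L2R) ξ := by
    intro N
    induction N with
    | zero =>
      simp only [Finset.range_zero, Finset.sum_empty, zero_apply, zero_mul,
        FourierTransform.fourier_zero]
      exact Lp.coeFn_zero ℂ 2 volume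
    | succ N ih =>
      rw [Finset.sum_range_succ, add_apply, smul_apply,
        FourierTransform.fourier_add, FourierTransform.fourier_smul]
      refine (Lp.coeFn_add _ _).trans ?_
      filter_upwards [ih, hpow N, Lp.coeFn_smul ((N.factorial : ℂ)⁻¹)
        (𝓕 ((((t : ℂ) • generator) ^ N) f) : L2R)] with ξ h1 h2 h3
      rw [Pi.add_apply, h1, h3, Pi.smul_apply, h2, smul_eq_mul, Finset.sum_range_succ]
      ring
  have hlim : Tendsto (fun N : ℕ ↦
      (𝓕 ((∑ n ∈ Finset.range N, ((n.factorial : ℂ)⁻¹) • ((t : ℂ) • generator) ^ n) f) : L2R))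
      atTop (𝓝 (𝓕 (group t f))) := by
    have h1 := (NormedSpace.exp_series_hasSum_exp' (𝕂 := ℂ)
      ((t : ℂ) • generator)).tendsto_sum_nat
    have h2 : Continuous fun T : L2R →L[ℂ] L2R ↦ (𝓕 (T f) : L2R) :=
      (Lp.fourierTransformₗᵢ ℝ ℂ).continuous.comp (ContinuousLinearMap.apply ℂ L2R f).continuous
    exact (h2.tendsto _).comp h1
  obtain ⟨ns, hns, hae⟩ := (tendstoInMeasure_of_tendsto_Lp hlim).exists_seq_tendsto_ae
  filter_upwards [hae, ae_all_iff.2 hpart] with ξ h1 h2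
  have h3 := ((NormedSpace.expSeries_div_hasSum_exp
    (t * symbolA ξ : ℂ)).tendsto_sum_nat.comp hns.tendsto_atTop).mul_const ((𝓕 f : L2R) ξ)
  rw [← Complex.exp_eq_exp_ℂ] at h3
  refine tendsto_nhds_unique (h1.congr fun n ↦ ?_) h3
  rw [h2]
  rfl

/-- The derivatives of the symbol of the group on `[0, ∞)`, in the variable
`q = (1 + 2π ξ)⁻¹`. -/
def profile : ℕ → ℝ → ℝ → ℂ
  | 0, t, q => Complex.exp (-(Complex.I * t * (1 - q)))
  | j + 1, t, q => -(2 * Real.pi * q ^ 2) * deriv (profile j t) q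

lemma hasDerivAt_exp_profile (t q : ℝ) :
    HasDerivAt (fun q : ℝ ↦ Complex.exp (-(Complex.I * t * (1 - q))))
      (Complex.exp (-(Complex.I * t * (1 - q))) * (Complex.I * t)) q := by
  have h : HasDerivAt (fun q : ℝ ↦ -(Complex.I * t * (1 - (q : ℂ)))) (Complex.I * t) q := by
    have := (((hasDerivAt_id q).ofReal_comp.const_sub 1).const_mul (Complex.I * t)).neg
    simp only [Complex.ofReal_one, mul_neg, mul_one, neg_neg] at this
    exact this
  exact h.cexp

/-- Each derivative falls either on the coefficients (`A`) or on the exponential (`B`), and the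
latter adds one power of `t`. So the degree in `t` is at most `j`, the source of the degree `r` in
the final bound. -/
lemma exists_profile_eq (j : ℕ) : ∃ b : ℕ → Polynomial ℂ, ∀ t q : ℝ,
    profile j t q = (∑ i ∈ Finset.range (j + 1), (t : ℂ) ^ i * (b i).eval (q : ℂ)) *
      Complex.exp (-(Complex.I * t * (1 - q))) := by
  induction j with
  | zero => exact ⟨fun _ ↦ 1, fun t q ↦ by simp [profile]⟩
  | succ j ih =>
    obtain ⟨b, hb⟩ := ih
    let A : ℕ → Polynomial ℂ := fun i ↦ Polynomial.C (-(2 * Real.pi : ℂ)) * Polynomial.X ^ 2 *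
      (b i).derivative
    let B : ℕ → Polynomial ℂ := fun i ↦ Polynomial.C (-(2 * Real.pi * Complex.I : ℂ)) *
      Polynomial.X ^ 2 * b i
    refine ⟨fun i ↦ (if i < j + 1 then A i else 0) + if i = 0 then 0 else B (i - 1),
      fun t q ↦ ?_⟩
    have hd : HasDerivAt (profile j t)
        ((∑ i ∈ Finset.range (j + 1), (t : ℂ) ^ i * (b i).derivative.eval (q : ℂ)) *
          Complex.exp (-(Complex.I * t * (1 - q))) +
        (∑ i ∈ Finset.range (j + 1), (t : ℂ) ^ i * (b i).eval (q : ℂ)) *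
          (Complex.exp (-(Complex.I * t * (1 - q))) * (Complex.I * t))) q := by
      rw [show profile j t = _ from funext (hb t)]
      refine HasDerivAt.mul ?_ (hasDerivAt_exp_profile t q)
      refine HasDerivAt.fun_sum fun i _ ↦ ?_
      exact ((b i).hasDerivAt (q : ℂ)).comp_ofReal.const_mul _
    rw [profile, hd.deriv]
    have e : ∑ i ∈ Finset.range (j + 1 + 1), (t : ℂ) ^ i *
        ((if i < j + 1 then A i else 0) + if i = 0 then 0 else B (i - 1)).eval (q : ℂ) =
        (∑ i ∈ Finset.range (j + 1), (t : ℂ) ^ i * (A i).eval (q : ℂ)) +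
        ∑ i ∈ Finset.range (j + 1), (t : ℂ) ^ (i + 1) * (B i).eval (q : ℂ) := by
      simp only [Polynomial.eval_add, mul_add, Finset.sum_add_distrib]
      congr 1
      · rw [Finset.sum_range_succ]
        simp only [lt_irrefl, if_false, Polynomial.eval_zero, mul_zero, add_zero]
        refine Finset.sum_congr rfl fun i hi ↦ ?_
        rw [if_pos (Finset.mem_range.1 hi)]
      · rw [Finset.sum_range_succ']
        simp
    rw [e, add_mul, mul_add]
    congr 1
    · rw [← mul_assoc, Finset.mul_sum]
      congr 1
      refine Finset.sum_congr rfl fun i _ ↦ ?_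
      simp only [A, Polynomial.eval_mul, Polynomial.eval_C, Polynomial.eval_pow, Polynomial.eval_X]
      ring
    · rw [← mul_assoc, Finset.mul_sum, ← mul_assoc, mul_right_comm, Finset.sum_mul]
      congr 1
      refine Finset.sum_congr rfl fun i _ ↦ ?_
      simp only [B, Polynomial.eval_mul, Polynomial.eval_C, Polynomial.eval_pow, Polynomial.eval_X]
      ring

lemma differentiable_profile (j : ℕ) (t : ℝ) : Differentiable ℝ (profile j t) := by
  obtain ⟨b, hb⟩ := exists_profile_eq j
  rw [show profile j t = _ from funext (hb t)]
  refine Differentiable.mul ?_ fun q ↦ (hasDerivAt_exp_profile t q).differentiableAt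
  refine Differentiable.fun_sum fun i _ q ↦ ?_
  exact ((b i).hasDerivAt (q : ℂ)).comp_ofReal.differentiableAt.const_mul _

lemma continuous_profile (j : ℕ) : Continuous fun p : ℝ × ℝ ↦ profile j p.1 p.2 := by
  obtain ⟨b, hb⟩ := exists_profile_eq j
  simp only [hb]
  fun_prop

lemma norm_exp_profile (t q : ℝ) : ‖Complex.exp (-(Complex.I * t * (1 - q)))‖ = 1 := by
  rw [show -(Complex.I * t * (1 - q) : ℂ) = ((-(t * (1 - q)) : ℝ) : ℂ) * Complex.I by
    push_cast; ring, Complex.norm_exp_ofReal_mul_I]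

/-- The frequency enters only through `q`, which stays in the compact interval `[0, 1]`. -/
lemma exists_norm_profile_le (j : ℕ) :
    ∃ C : ℝ, ∀ t, ∀ q ∈ Icc (0 : ℝ) 1, ‖profile j t q‖ ≤ C * (1 + |t|) ^ j := by
  obtain ⟨b, hb⟩ := exists_profile_eq j
  have hbd : ∀ i, ∃ C, ∀ q ∈ Icc (0 : ℝ) 1, ‖(b i).eval (q : ℂ)‖ ≤ C := fun i ↦
    isCompact_Icc.exists_bound_of_continuousOn (by fun_prop)
  choose C hC using hbd
  refine ⟨∑ i ∈ Finset.range (j + 1), C i, fun t q hq ↦ ?_⟩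
  rw [hb, norm_mul, norm_exp_profile, mul_one, Finset.sum_mul]
  refine norm_sum_le_of_le _ fun i hi ↦ ?_
  rw [norm_mul, norm_pow, Complex.norm_real, Real.norm_eq_abs, mul_comm]
  have h1 : |t| ^ i ≤ (1 + |t|) ^ j :=
    (pow_le_pow_left₀ (abs_nonneg t) (by linarith) i).trans
      (pow_le_pow_right₀ (by linarith [abs_nonneg t]) (Finset.mem_range_succ_iff.1 hi))
  exact mul_le_mul (hC i q hq) h1 (by positivity) ((norm_nonneg _).trans (hC i q hq))

lemma profile_zero_one (t : ℝ) : profile 0 t 1 = 1 := by simp [profile]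

lemma profile_one (t q : ℝ) : profile 1 t q =
    -(2 * Real.pi * Complex.I * t) * ((q : ℂ) ^ 2 *
      Complex.exp (-(Complex.I * t * (1 - q)))) := by
  have : deriv (profile 0 t) q = _ := (hasDerivAt_exp_profile t q).deriv
  rw [profile, this]
  ring

lemma profile_two_one (t : ℝ) :
    profile 2 t 1 = 4 * Real.pi ^ 2 * (2 * Complex.I * t - t ^ 2) := by
  have h := (((hasDerivAt_id (1 : ℝ)).ofReal_comp.fun_pow 2).fun_mul
    (hasDerivAt_exp_profile t 1)).const_mul (-(2 * Real.pi * Complex.I * t))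
  rw [profile, show profile 1 t = _ from funext (profile_one t)]
  simp only [id] at h
  rw [h.deriv]
  simp
  ring_nf
  simp
  ring

namespace PiecewiseSymbol

/-- The difference of two piecewise smooth symbols. -/
def sub (M N : PiecewiseSymbol) : PiecewiseSymbol where
  pos j ξ := M.pos j ξ - N.pos j ξ
  neg j ξ := M.neg j ξ - N.neg j ξ
  hasDerivAt_pos j ξ h := (M.hasDerivAt_pos j ξ h).sub (N.hasDerivAt_pos j ξ h)
  hasDerivAt_neg j ξ h := (M.hasDerivAt_neg j ξ h).sub (N.hasDerivAt_neg j ξ h)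
  bounded j := by
    obtain ⟨C, h1, h2⟩ := M.bounded j
    obtain ⟨D, h3, h4⟩ := N.bounded j
    exact ⟨C + D, fun ξ h ↦ (norm_sub_le _ _).trans (add_le_add (h1 ξ h) (h3 ξ h)),
      fun ξ h ↦ (norm_sub_le _ _).trans (add_le_add (h2 ξ h) (h4 ξ h))⟩

lemma symbol_sub (M N : PiecewiseSymbol) (j : ℕ) (ξ : ℝ) :
    (M.sub N).symbol j ξ = M.symbol j ξ - N.symbol j ξ := by
  rcases le_or_gt 0 ξ with h | h
  · simp only [symbol_of_nonneg _ _ h, sub]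
  · simp only [symbol_of_neg _ _ h, sub]

lemma op_sub (M N : PiecewiseSymbol) (j : ℕ) (f : L2R) :
    (M.sub N).op j f = M.op j f - N.op j f := by
  refine (Lp.fourierTransformₗᵢ ℝ ℂ).injective ?_
  rw [map_sub]
  refine Lp.ext ?_
  refine ((M.sub N).coeFn_fourier_op j f).trans (.trans ?_ (Lp.coeFn_sub _ _).symm)
  filter_upwards [M.coeFn_fourier_op j f, N.coeFn_fourier_op j f] with ξ h1 h2
  rw [symbol_sub, sub_mul, ← h1, ← h2]
  rfl

lemma Compatible.sub {M N : PiecewiseSymbol} {j : ℕ} {f : L2R} (hM : M.Compatible j f)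
    (hN : N.Compatible j f) : (M.sub N).Compatible j f := by
  unfold Compatible at *
  simp only [PiecewiseSymbol.sub, sub_mul, hM, hN]

end PiecewiseSymbol

lemma inv_one_add_mem_Icc {x : ℝ} (hx : 0 ≤ x) : (1 + x)⁻¹ ∈ Icc (0 : ℝ) 1 :=
  ⟨by positivity, inv_le_one_of_one_le₀ (by linarith)⟩

/-- Chain rule: `dq/dξ = -2π ε q²`, the factor built into `profile`. The values `ε = 1` and `ε = -1`
serve the two half-lines. -/
lemma hasDerivAt_profile_comp (j : ℕ) (t ε ξ : ℝ) (h : 0 < 1 + 2 * Real.pi * (ε * ξ)) :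
    HasDerivAt (fun ξ : ℝ ↦ profile j t (1 + 2 * Real.pi * (ε * ξ))⁻¹)
      (ε * profile (j + 1) t (1 + 2 * Real.pi * (ε * ξ))⁻¹) ξ := by
  have h1 : HasDerivAt (fun ξ : ℝ ↦ 1 + 2 * Real.pi * (ε * ξ)) (2 * Real.pi * ε) ξ := by
    have := (((hasDerivAt_id ξ).const_mul ε).const_mul (2 * Real.pi)).const_add 1
    simpa using this
  have h2 := ((differentiable_profile j t _).hasDerivAt.scomp ξ (h1.inv h.ne'))
  refine h2.congr_deriv ?_
  rw [profile, Complex.real_smul, Pi.inv_apply]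
  push_cast
  field_simp

/-- The symbol of the group, with all its derivatives. -/
def groupSymbol (t : ℝ) : PiecewiseSymbol where
  pos j ξ := profile j t (1 + 2 * Real.pi * (1 * ξ))⁻¹
  -- `symbolA` is odd, so reflecting `ξ` amounts to reversing time; the sign comes from the chain
  -- rule.
  neg j ξ := (-1) ^ j * profile j (-t) (1 + 2 * Real.pi * (-1 * ξ))⁻¹
  hasDerivAt_pos j ξ h := by
    simpa using hasDerivAt_profile_comp j t 1 ξ (by positivity)
  hasDerivAt_neg j ξ h := by
    have h0 : 0 ≤ -1 * ξ := by linarith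
    refine ((hasDerivAt_profile_comp j (-t) (-1) ξ (by positivity)).const_mul
      ((-1 : ℂ) ^ j)).congr_deriv ?_
    push_cast
    ring
  bounded j := by
    obtain ⟨C, hC⟩ := exists_norm_profile_le j
    refine ⟨C * (1 + |t|) ^ j, fun ξ h ↦ hC _ _ (inv_one_add_mem_Icc (by positivity)),
      fun ξ h ↦ ?_⟩
    have h0 : 0 ≤ -1 * ξ := by linarith
    rw [norm_mul, norm_pow, norm_neg, norm_one, one_pow, one_mul]
    simpa using hC (-t) _ (inv_one_add_mem_Icc (x := 2 * Real.pi * (-1 * ξ)) (by positivity))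

lemma exists_norm_groupSymbol_le (j : ℕ) :
    ∃ C : ℝ, ∀ t ξ, ‖(groupSymbol t).symbol j ξ‖ ≤ C * (1 + |t|) ^ j := by
  obtain ⟨C, hC⟩ := exists_norm_profile_le j
  refine ⟨C, fun t ξ ↦ ?_⟩
  rcases le_or_gt 0 ξ with h | h
  · rw [PiecewiseSymbol.symbol_of_nonneg _ _ h]
    exact hC _ _ (inv_one_add_mem_Icc (by positivity))
  · rw [PiecewiseSymbol.symbol_of_neg _ _ h]
    have h0 : 0 ≤ -1 * ξ := by linarith
    simp only [groupSymbol]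
    rw [norm_mul, norm_pow, norm_neg, norm_one, one_pow, one_mul]
    simpa using hC (-t) _ (inv_one_add_mem_Icc (x := 2 * Real.pi * (-1 * ξ)) (by positivity))

/-- The derivatives of the symbol depend continuously on the time, uniformly in `ξ`. -/
lemma eventually_norm_groupSymbol_sub_le (j : ℕ) (t₀ : ℝ) {ε : ℝ} (hε : 0 < ε) :
    ∀ᶠ t in 𝓝 t₀, ∀ ξ, ‖((groupSymbol t).sub (groupSymbol t₀)).symbol j ξ‖ ≤ ε := by
  have key : ∀ t₁ : ℝ, ∀ᶠ t in 𝓝 t₁, ∀ q ∈ Icc (0 : ℝ) 1,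
      ‖profile j t q - profile j t₁ q‖ < ε := by
    intro t₁
    -- Joint continuity and compactness in `q` give uniformity.
    refine isCompact_Icc.eventually_forall_of_forall_eventually fun q _ ↦ ?_
    have hcont : Continuous fun z : ℝ × ℝ ↦ ‖profile j z.1 z.2 - profile j t₁ z.2‖ :=
      ((continuous_profile j).sub ((continuous_profile j).comp
        (continuous_const.prodMk continuous_snd))).norm
    exact hcont.continuousAt.eventually_lt continuousAt_const (by simpa using hε)
  have hneg : Tendsto (fun t : ℝ ↦ -t) (𝓝 t₀) (𝓝 (-t₀)) := continuous_neg.tendsto _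
  filter_upwards [key t₀, hneg.eventually (key (-t₀))] with t h1 h2 ξ
  rw [PiecewiseSymbol.symbol_sub]
  rcases le_or_gt 0 ξ with h | h
  · simp only [PiecewiseSymbol.symbol_of_nonneg _ _ h]
    exact (h1 _ (inv_one_add_mem_Icc (by positivity))).le
  · simp only [PiecewiseSymbol.symbol_of_neg _ _ h]
    have h0 : 0 ≤ -1 * ξ := by linarith
    simp only [groupSymbol]
    rw [← mul_sub, norm_mul, norm_pow, norm_neg, norm_one, one_pow, one_mul]
    exact (h2 _ (inv_one_add_mem_Icc (by positivity))).le

lemma groupSymbol_zero (t ξ : ℝ) : (groupSymbol t).symbol 0 ξ = Complex.exp (t * symbolA ξ) := by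
  rw [symbolA_eq]
  rcases le_or_gt 0 ξ with h | h
  · rw [PiecewiseSymbol.symbol_of_nonneg _ _ h, abs_of_nonneg (by positivity)]
    have : (1 + 2 * Real.pi * ξ : ℂ) ≠ 0 := by
      exact_mod_cast (by positivity : (1 + 2 * Real.pi * ξ : ℝ) ≠ 0)
    simp only [groupSymbol, profile]
    congr 1
    push_cast
    field_simp
    ring
  · have h0 : 0 < -ξ := by linarith
    have h1 : (0 : ℝ) < 1 - 2 * Real.pi * ξ := by
      have : 0 < 2 * Real.pi * -ξ := by positivity
      linarith
    rw [PiecewiseSymbol.symbol_of_neg _ _ h,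
      abs_of_neg (mul_neg_of_pos_of_neg Real.two_pi_pos h)]
    have : (1 - 2 * Real.pi * ξ : ℂ) ≠ 0 := by exact_mod_cast h1.ne'
    have : (1 + 2 * Real.pi * (-1 * ξ) : ℂ) ≠ 0 := by
      rwa [show (1 + 2 * Real.pi * (-1 * ξ) : ℂ) = 1 - 2 * Real.pi * ξ by ring]
    have : (1 + -(2 * Real.pi * ξ) : ℂ) ≠ 0 := by
      rwa [show (1 + -(2 * Real.pi * ξ) : ℂ) = 1 - 2 * Real.pi * ξ by ring]
    simp only [groupSymbol, profile, pow_zero, one_mul]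
    congr 1
    push_cast
    field_simp
    ring

lemma group_eq_op (t : ℝ) (f : L2R) : group t f = (groupSymbol t).op 0 f := by
  refine (Lp.fourierTransformₗᵢ ℝ ℂ).injective (Lp.ext ?_)
  refine (coeFn_fourier_group t f).trans (.trans ?_ ((groupSymbol t).coeFn_fourier_op 0 f).symm)
  exact .of_forall fun ξ ↦ by simp only [groupSymbol_zero]

/-- On both sides the value is `1` and the slope is `-2πit`. -/
lemma groupSymbol_pos_eq_neg (t : ℝ) {j : ℕ} (hj : j < 2) :
    (groupSymbol t).pos j 0 = (groupSymbol t).neg j 0 := by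
  interval_cases j
  · simp [groupSymbol, profile_zero_one]
  · simp [groupSymbol, profile_one]

/-- The two sides differ by `t ↦ -t`, so the `t ^ 2` term of `profile_two_one` cancels and the odd
term doubles. -/
lemma groupSymbol_jump (t : ℝ) :
    (groupSymbol t).pos 2 0 - (groupSymbol t).neg 2 0 = 16 * Real.pi ^ 2 * Complex.I * t := by
  simp [groupSymbol, profile_two_one]
  ring

/-! ### Jumps at the origin -/

namespace PiecewiseSymbol

variable (M : PiecewiseSymbol)

lemma coeFn_fourier_leibniz {f : ℕ → L2R} {k : ℕ} (hf : ∀ i ≤ k, Integrable (f i : ℝ → ℂ)) :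
    (𝓕 (M.leibniz f k) : L2R) =ᵐ[volume] fun ξ ↦ ∑ p ∈ Finset.HasAntidiagonal.antidiagonal k,
      k.choose p.1 * ((Complex.I / (2 * Real.pi)) ^ p.1 *
        (M.symbol p.1 ξ * 𝓕 (f p.2 : ℝ → ℂ) ξ)) := by
  have h : (𝓕 (M.leibniz f k) : L2R) = ∑ p ∈ Finset.HasAntidiagonal.antidiagonal k,
      (k.choose p.1 : ℂ) • ((Complex.I / (2 * Real.pi) : ℂ) ^ p.1 •
        (𝓕 (M.op p.1 (f p.2)) : L2R)) := by
    change Lp.fourierTransformₗᵢ ℝ ℂ _ = _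
    rw [leibniz, map_sum]
    refine Finset.sum_congr rfl fun p _ ↦ ?_
    rw [map_nsmul, map_smul, Nat.cast_smul_eq_nsmul]
    rfl
  have hterm : ∀ p ∈ Finset.HasAntidiagonal.antidiagonal k, ∀ᵐ ξ,
      ((k.choose p.1 : ℂ) • ((Complex.I / (2 * Real.pi) : ℂ) ^ p.1 •
        (𝓕 (M.op p.1 (f p.2)) : L2R)) : L2R) ξ =
      k.choose p.1 * ((Complex.I / (2 * Real.pi)) ^ p.1 *
        (M.symbol p.1 ξ * 𝓕 (f p.2 : ℝ → ℂ) ξ)) := by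
    intro p hp
    have hp' := Finset.HasAntidiagonal.mem_antidiagonal.1 hp
    refine (Lp.coeFn_smul _ _).trans ?_
    filter_upwards [Lp.coeFn_smul ((Complex.I / (2 * Real.pi) : ℂ) ^ p.1)
      (𝓕 (M.op p.1 (f p.2)) : L2R), M.coeFn_fourier_op p.1 (f p.2),
      coeFn_fourier_of_integrable _ (hf p.2 (by omega))] with ξ h1 h2 h3
    rw [Pi.smul_apply, h1, Pi.smul_apply, h2, h3, smul_eq_mul, smul_eq_mul]
  rw [h]
  refine (Lp.coeFn_fun_finsetSum _ _).trans ?_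
  filter_upwards [(Filter.eventually_all_finset _).2 hterm] with ξ hξ
  exact Finset.sum_congr rfl hξ

/-- If a Leibniz expansion is integrable, its Fourier transform has no jump at the origin. -/
lemma sum_jump_eq_zero {f : ℕ → L2R} {k : ℕ} (hf : ∀ i ≤ k, Integrable (f i : ℝ → ℂ))
    (hk : Integrable (M.leibniz f k : ℝ → ℂ)) :
    ∑ p ∈ Finset.HasAntidiagonal.antidiagonal k,
      (k.choose p.1 : ℂ) * ((Complex.I / (2 * Real.pi)) ^ p.1 *
        ((M.pos p.1 0 - M.neg p.1 0) * 𝓕 (f p.2 : ℝ → ℂ) 0)) = 0 := by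
  have hU := (coeFn_fourier_of_integrable _ hk).symm.trans (M.coeFn_fourier_leibniz hf)
  have hc := continuous_fourier hk
  have hfc : ∀ p ∈ Finset.HasAntidiagonal.antidiagonal k, Continuous (𝓕 (f p.2 : ℝ → ℂ)) :=
    fun p hp ↦ continuous_fourier
      (hf p.2 (by have := Finset.HasAntidiagonal.mem_antidiagonal.1 hp; omega))
  -- Both sides are continuous on the closed half-line, so equality almost everywhere extends to the
  -- origin.
  have hpos : EqOn (𝓕 (M.leibniz f k : ℝ → ℂ)) (fun ξ ↦
      ∑ p ∈ Finset.HasAntidiagonal.antidiagonal k,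
      (k.choose p.1 : ℂ) * ((Complex.I / (2 * Real.pi)) ^ p.1 *
        (M.pos p.1 ξ * 𝓕 (f p.2 : ℝ → ℂ) ξ))) (Ici 0) := by
    refine Measure.eqOn_of_ae_eq (μ := volume) ?_ hc.continuousOn ?_ (by simp)
    · rw [EventuallyEq, ae_restrict_iff' measurableSet_Ici]
      filter_upwards [hU] with ξ h1 h2
      simp only [h1, M.symbol_of_nonneg _ h2]
    · exact continuousOn_finsetSum _ fun p hp ↦ continuousOn_const.mul (continuousOn_const.mul
        ((M.continuousOn_pos _).mul (hfc p hp).continuousOn))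
  have hneg : EqOn (𝓕 (M.leibniz f k : ℝ → ℂ)) (fun ξ ↦
      ∑ p ∈ Finset.HasAntidiagonal.antidiagonal k,
      (k.choose p.1 : ℂ) * ((Complex.I / (2 * Real.pi)) ^ p.1 *
        (M.neg p.1 ξ * 𝓕 (f p.2 : ℝ → ℂ) ξ))) (Iic 0) := by
    refine Measure.eqOn_of_ae_eq (μ := volume) ?_ hc.continuousOn ?_ (by simp)
    · rw [EventuallyEq, ae_restrict_iff' measurableSet_Iic]
      filter_upwards [hU, Measure.ae_ne volume (0 : ℝ)] with ξ h1 h2 h3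
      simp only [h1, M.symbol_of_neg _ (lt_of_le_of_ne h3 h2)]
    · exact continuousOn_finsetSum _ fun p hp ↦ continuousOn_const.mul (continuousOn_const.mul
        ((M.continuousOn_neg _).mul (hfc p hp).continuousOn))
  have h := (hpos self_mem_Ici).symm.trans (hneg self_mem_Iic)
  rw [← sub_eq_zero, ← Finset.sum_sub_distrib] at h
  rw [← h]
  exact Finset.sum_congr rfl fun p _ ↦ by ring

end PiecewiseSymbol

lemma ae_eq_pow_mul {g : ℕ → L2R} {n : ℕ} (hg : ∀ k < n, IsMulX (g k) (g (k + 1))) :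
    ∀ᵐ x : ℝ, g n x = (x : ℂ) ^ n * g 0 x := by
  induction n with
  | zero => simp
  | succ n ih =>
    filter_upwards [ih fun k hk ↦ hg k (by omega), hg n (by omega)] with x h1 h2
    rw [h2, h1]
    ring

namespace WeightedSobolev

variable {s : ℝ} {r : ℕ}

/-! ### Norms and moments of functions with a weight of integral order -/

lemma norm_sq_eq_add (f : WeightedSobolev s r) :
    ‖f‖ ^ 2 = ‖f.memLp_sobolev.toLp _‖ ^ 2 + ‖f.memLp_weight.toLp _‖ ^ 2 :=
  WithLp.prod_norm_sq_eq_of_L2 (embed f)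

lemma norm_sobolev_le (f : WeightedSobolev s r) : ‖f.memLp_sobolev.toLp _‖ ≤ ‖f‖ := by
  refine le_of_sq_le_sq ?_ (norm_nonneg f)
  rw [norm_sq_eq_add]
  exact le_add_of_nonneg_right (sq_nonneg _)

lemma norm_weight_le (f : WeightedSobolev s r) : ‖f.memLp_weight.toLp _‖ ≤ ‖f‖ := by
  refine le_of_sq_le_sq ?_ (norm_nonneg f)
  rw [norm_sq_eq_add]
  exact le_add_of_nonneg_left (sq_nonneg _)

lemma norm_le_add (f : WeightedSobolev s r) :
    ‖f‖ ≤ ‖f.memLp_sobolev.toLp _‖ + ‖f.memLp_weight.toLp _‖ := by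
  refine le_of_sq_le_sq ?_ (by positivity)
  rw [norm_sq_eq_add]
  nlinarith [norm_nonneg (f.memLp_sobolev.toLp _), norm_nonneg (f.memLp_weight.toLp _)]

lemma norm_toL2_le (hs : 0 ≤ s) (f : WeightedSobolev s r) : ‖f.toL2‖ ≤ ‖f‖ := by
  refine le_trans ?_ f.norm_sobolev_le
  rw [← Lp.norm_fourier_eq f.toL2]
  refine Lp.norm_le_norm_of_ae_le ?_
  filter_upwards [f.memLp_sobolev.coeFn_toLp] with ξ hξ
  rw [hξ, norm_mul]
  refine le_mul_of_one_le_left (norm_nonneg _) ?_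
  have h : 1 ≤ sobolevWeight s ξ :=
    Real.one_le_rpow (le_add_of_nonneg_right (sq_nonneg _)) (by positivity)
  rw [Complex.norm_real, Real.norm_of_nonneg (zero_le_one.trans h)]
  exact h

/-- Lower powers are controlled by `|x| ^ k ≤ 1 + |x| ^ r`. -/
lemma norm_pow_mul_le (f : WeightedSobolev s r) {k : ℕ} (hk : k ≤ r) :
    ∀ᵐ x : ℝ, ‖(x : ℂ) ^ k * f.toL2 x‖ ≤ ‖(f.toL2 + f.memLp_weight.toLp _ : L2R) x‖ := by
  filter_upwards [Lp.coeFn_add f.toL2 (f.memLp_weight.toLp _), f.memLp_weight.coeFn_toLp]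
    with x h1 h2
  rw [h1, Pi.add_apply, h2, ← one_add_mul, norm_mul, norm_mul, norm_pow, Complex.norm_real,
    Real.norm_eq_abs, Real.rpow_natCast]
  refine mul_le_mul_of_nonneg_right ?_ (norm_nonneg _)
  have e : (1 : ℂ) + ((|x| ^ r : ℝ) : ℂ) = ((1 + |x| ^ r : ℝ) : ℂ) := by push_cast; rfl
  rw [e, Complex.norm_real, Real.norm_of_nonneg (by positivity)]
  rcases le_total |x| 1 with h | h
  · exact (pow_le_one₀ (abs_nonneg x) h).trans (le_add_of_nonneg_right (by positivity))
  · exact (pow_le_pow_right₀ h hk).trans (by linarith)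

lemma memLp_pow_mul (f : WeightedSobolev s r) {k : ℕ} (hk : k ≤ r) :
    MemLp (fun x : ℝ ↦ (x : ℂ) ^ k * f.toL2 x) 2 volume := by
  refine (Lp.memLp (f.toL2 + f.memLp_weight.toLp _)).of_le ?_ (f.norm_pow_mul_le hk)
  exact (Continuous.aestronglyMeasurable (by fun_prop)).mul (Lp.memLp _).1

/-- The function `x ^ k f`, for `k ≤ r`. -/
def moment (f : WeightedSobolev s r) (k : ℕ) : L2R :=
  if hk : k ≤ r then (f.memLp_pow_mul hk).toLp _ else 0

lemma coeFn_moment (f : WeightedSobolev s r) {k : ℕ} (hk : k ≤ r) :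
    f.moment k =ᵐ[volume] fun x : ℝ ↦ (x : ℂ) ^ k * f.toL2 x := by
  rw [moment, dif_pos hk]
  exact (f.memLp_pow_mul hk).coeFn_toLp

lemma moment_zero (f : WeightedSobolev s r) : f.moment 0 = f.toL2 := by
  refine Lp.ext ?_
  filter_upwards [f.coeFn_moment (zero_le (a := r))] with x hx
  rw [hx, pow_zero, one_mul]

lemma isMulX_moment (f : WeightedSobolev s r) {k : ℕ} (hk : k < r) :
    IsMulX (f.moment k) (f.moment (k + 1)) := by
  filter_upwards [f.coeFn_moment hk.le, f.coeFn_moment (k := k + 1) hk] with x h1 h2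
  rw [h1, h2, pow_succ', mul_assoc]

lemma norm_moment_le (hs : 0 ≤ s) (f : WeightedSobolev s r) {k : ℕ} (hk : k ≤ r) :
    ‖f.moment k‖ ≤ 2 * ‖f‖ := by
  have h : ‖f.moment k‖ ≤ ‖f.toL2 + f.memLp_weight.toLp _‖ := by
    refine Lp.norm_le_norm_of_ae_le ?_
    filter_upwards [f.coeFn_moment hk, f.norm_pow_mul_le hk] with x h1 h2
    rwa [h1]
  calc _ ≤ _ := h
    _ ≤ _ := norm_add_le _ _
    _ ≤ ‖f‖ + ‖f‖ := add_le_add (f.norm_toL2_le hs) f.norm_weight_le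
    _ = _ := (two_mul _).symm

lemma integrable_moment (f : WeightedSobolev s r) {k : ℕ} (hk : k < r) :
    Integrable (f.moment k : ℝ → ℂ) :=
  (f.isMulX_moment hk).integrable

lemma iteratedDeriv_fourier (f : WeightedSobolev s r) {k : ℕ} (hk : k < r) :
    iteratedDeriv k (𝓕 (f.toL2 : ℝ → ℂ)) 0 =
      (-2 * Real.pi * Complex.I) ^ k * 𝓕 (f.moment k : ℝ → ℂ) 0 := by
  have hi : ∀ n : ℕ, (n : ℕ∞) ≤ (k : ℕ∞) → Integrable fun x : ℝ ↦ x ^ n • f.toL2 x := by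
    intro n hn
    have hn' : n ≤ k := by exact_mod_cast hn
    refine (f.integrable_moment (hn'.trans_lt hk)).congr ?_
    filter_upwards [f.coeFn_moment (hn'.trans hk.le)] with x hx
    rw [hx, Complex.real_smul]
    push_cast
    rfl
  rw [Real.iteratedDeriv_fourier hi le_rfl, Real.fourier_eq', Real.fourier_eq',
    ← integral_const_mul]
  refine integral_congr_ae ?_
  filter_upwards [f.coeFn_moment hk.le] with x hx
  rw [hx, smul_eq_mul, smul_eq_mul, smul_eq_mul]
  ring

lemma momentsVanish_iff (f : WeightedSobolev s r) :
    MomentsVanish r f.toL2 ↔ ∀ j, j + 3 ≤ r → 𝓕 (f.moment j : ℝ → ℂ) 0 = 0 := by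
  refine forall₂_congr fun j hj ↦ ?_
  rw [f.iteratedDeriv_fourier (by omega), mul_eq_zero, or_iff_right]
  exact pow_ne_zero _ (by simp [Real.pi_ne_zero])

/-- A multiplier with a piecewise smooth symbol preserves the weighted space if the moments of the
function compensate the jumps of the symbol. -/
lemma exists_toL2_eq_op (M : PiecewiseSymbol) (hs : 0 ≤ s) (f : WeightedSobolev s r)
    (hf : ∀ i j, i + j < r → M.Compatible i (f.moment j)) {c : ℕ → ℝ}
    (hc : ∀ j ≤ r, ∀ ξ, ‖M.symbol j ξ‖ ≤ c j) :
    ∃ ψ : WeightedSobolev s r, ψ.toL2 = M.op 0 f.toL2 ∧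
      ‖ψ‖ ≤ (c 0 + 2 * ∑ p ∈ Finset.HasAntidiagonal.antidiagonal r, r.choose p.1 * c p.1) *
        ‖f‖ := by
  have hmul : ∀ᵐ x : ℝ, M.leibniz f.moment r x = (x : ℂ) ^ r * M.op 0 f.toL2 x := by
    have := ae_eq_pow_mul (g := M.leibniz f.moment) (n := r) fun k hk ↦
      M.isMulX_leibniz (fun i hi ↦ f.isMulX_moment (by omega)) fun i j hij ↦ hf i j (by omega)
    rwa [M.leibniz_zero, f.moment_zero] at this
  have hw : ∀ᵐ x : ℝ, ‖((|x| ^ (r : ℝ) : ℝ) : ℂ) * M.op 0 f.toL2 x‖ ≤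
      1 * ‖M.leibniz f.moment r x‖ := by
    filter_upwards [hmul] with x hx
    rw [hx, norm_mul, norm_mul, norm_pow, Complex.norm_real, Complex.norm_real,
      Real.rpow_natCast, one_mul, norm_pow, Real.norm_eq_abs, abs_abs]
    rfl
  have hsob : ∀ᵐ ξ : ℝ, ‖(sobolevWeight s ξ : ℂ) * (𝓕 (M.op 0 f.toL2) : L2R) ξ‖ ≤
      c 0 * ‖(f.memLp_sobolev.toLp _ : L2R) ξ‖ := by
    filter_upwards [M.coeFn_fourier_op 0 f.toL2, f.memLp_sobolev.coeFn_toLp] with ξ h1 h2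
    rw [h1, h2, mul_left_comm, norm_mul]
    exact mul_le_mul_of_nonneg_right (hc 0 (Nat.zero_le r) ξ) (norm_nonneg _)
  have hm1 : MemLp (fun ξ ↦ (sobolevWeight s ξ : ℂ) * (𝓕 (M.op 0 f.toL2) : L2R) ξ) 2 volume := by
    refine (Lp.memLp (f.memLp_sobolev.toLp _)).of_le_mul ?_ hsob
    refine AEStronglyMeasurable.mul (Measurable.aestronglyMeasurable ?_) (Lp.memLp _).1
    unfold sobolevWeight
    fun_prop
  have hm2 : MemLp (fun x ↦ ((|x| ^ (r : ℝ) : ℝ) : ℂ) * M.op 0 f.toL2 x) 2 volume := by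
    refine (Lp.memLp (M.leibniz f.moment r)).of_le_mul ?_ hw
    exact AEStronglyMeasurable.mul (Measurable.aestronglyMeasurable (by fun_prop)) (Lp.memLp _).1
  let ψ : WeightedSobolev s r := (⟨M.op 0 f.toL2, hm1, hm2⟩ : ↥(weightedSobolevSubmodule s r))
  have h0 : 0 ≤ c 0 := (norm_nonneg _).trans (hc 0 (Nat.zero_le r) 0)
  refine ⟨ψ, rfl, ψ.norm_le_add.trans ?_⟩
  rw [add_mul]
  refine add_le_add ?_ ?_
  · refine le_trans (Lp.norm_le_mul_norm_of_ae_le_mul ?_)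
      (mul_le_mul_of_nonneg_left f.norm_sobolev_le h0)
    filter_upwards [ψ.memLp_sobolev.coeFn_toLp, hsob] with ξ h1 h2
    rw [h1]
    exact h2
  · rw [mul_comm (2 : ℝ), mul_assoc]
    refine le_trans ?_ (M.norm_leibniz_le hc fun i hi ↦ f.norm_moment_le hs hi)
    rw [← one_mul ‖M.leibniz f.moment r‖]
    refine Lp.norm_le_mul_norm_of_ae_le_mul ?_
    filter_upwards [ψ.memLp_weight.coeFn_toLp, hw] with x h1 h2
    rw [h1]
    exact h2

/-- Orders below two have no jump; if `2 ≤ i`, then `i + j < r` gives `j + 3 ≤ r`, exactly the range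
of the moment conditions. -/
lemma compatible_moment (f : WeightedSobolev s r) (hf : MomentsVanish r f.toL2) (t : ℝ)
    (i j : ℕ) (hij : i + j < r) : (groupSymbol t).Compatible i (f.moment j) := by
  unfold PiecewiseSymbol.Compatible
  rcases lt_or_ge i 2 with hi | hi
  · rw [groupSymbol_pos_eq_neg t hi]
  · rw [f.momentsVanish_iff.1 hf j (by omega), mul_zero, mul_zero]

end WeightedSobolev

/-! ### Polynomial bound, continuity in time and necessity of the moment conditions -/

open WeightedSobolev

lemma isPositivePolynomial_C_mul (r : ℕ) {K : ℝ} (hK : 0 < K) :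
    IsPositivePolynomial r (Polynomial.C K * (Polynomial.X + 1) ^ r) := by
  constructor
  · rw [Polynomial.natDegree_C_mul hK.ne', ← Polynomial.C_1, Polynomial.natDegree_pow_X_add_C]
  · intro k hk
    rw [Polynomial.coeff_C_mul, Polynomial.coeff_X_add_one_pow]
    have := Nat.choose_pos hk
    positivity

/-- The polynomial bound on the group, in all cases. -/
lemma exists_groupBound (r : ℕ) : ∃ P : Polynomial ℝ, IsPositivePolynomial r P ∧
    ∀ s : ℝ, 0 ≤ s → ∀ φ : WeightedSobolev s r, MomentsVanish r φ.toL2 → GroupBound P φ := by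
  choose C hC using exists_norm_groupSymbol_le
  set K : ℝ := |C 0| + 2 * ∑ p ∈ Finset.HasAntidiagonal.antidiagonal r, r.choose p.1 * |C p.1|
    with hK
  have hK0 : 0 ≤ K := by positivity
  -- `K` is only known to be nonnegative; `K + 1` makes every coefficient of the polynomial
  -- positive.
  refine ⟨_, isPositivePolynomial_C_mul r (K := K + 1) (by positivity), fun s hs φ hφ t ↦ ?_⟩
  obtain ⟨ψ, h1, h2⟩ := φ.exists_toL2_eq_op (groupSymbol t) hs (φ.compatible_moment hφ t)
    (c := fun j ↦ |C j| * (1 + |t|) ^ r) fun j hj ξ ↦ (hC j t ξ).trans <|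
      mul_le_mul (le_abs_self _) (pow_le_pow_right₀ (by linarith [abs_nonneg t]) hj)
        (by positivity) (abs_nonneg _)
  refine ⟨ψ, by rw [h1, group_eq_op], h2.trans (mul_le_mul_of_nonneg_right ?_ (norm_nonneg _))⟩
  simp only [← mul_assoc, ← Finset.sum_mul, ← add_mul, Polynomial.eval_mul, Polynomial.eval_C,
    Polynomial.eval_pow, Polynomial.eval_add, Polynomial.eval_X, Polynomial.eval_one]
  rw [add_comm |t| 1, hK]
  exact mul_le_mul_of_nonneg_right (le_add_of_nonneg_right zero_le_one) (by positivity)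

/-- `E(t) - E(t₀)` is a multiplier whose symbol is compatible with the same moments and has
uniformly small derivatives up to order `r`. -/
lemma groupContinuous_of_momentsVanish {s : ℝ} {r : ℕ} (hs : 0 ≤ s) (φ : WeightedSobolev s r)
    (hφ : MomentsVanish r φ.toL2) : GroupContinuous φ := by
  obtain ⟨P, -, hP⟩ := exists_groupBound r
  choose u hu _ using hP s hs φ hφ
  suffices h : Continuous u from ⟨⟨fun t ↦ u t, h.comp continuous_subtype_val⟩, fun t ↦ hu t⟩
  refine continuous_iff_continuousAt.2 fun t₀ ↦ Metric.tendsto_nhds.2 fun ε hε ↦ ?_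
  -- The constant of `exists_toL2_eq_op` when all derivatives have the bound `1`.
  set S : ℝ := 1 + 2 * ∑ p ∈ Finset.HasAntidiagonal.antidiagonal r, (r.choose p.1 : ℝ) with hS
  have hS0 : 0 < S := by positivity
  have hφ1 : 0 < ‖φ‖ + 1 := by positivity
  have hδ : 0 < ε / (S * (‖φ‖ + 1)) := by positivity
  filter_upwards [(Filter.eventually_all_finset (Finset.range (r + 1))).2 fun j _ ↦
    eventually_norm_groupSymbol_sub_le j t₀ hδ] with t ht
  obtain ⟨ψ, h1, h2⟩ := φ.exists_toL2_eq_op ((groupSymbol t).sub (groupSymbol t₀)) hs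
    (fun i j hij ↦ (φ.compatible_moment hφ t i j hij).sub (φ.compatible_moment hφ t₀ i j hij))
    (c := fun _ ↦ ε / (S * (‖φ‖ + 1))) fun j hj ξ ↦ ht j (by simpa [Nat.lt_succ_iff] using hj) ξ
  have e : u t - u t₀ = ψ := by
    apply toL2_injective
    rw [map_sub, hu, hu, h1, group_eq_op, group_eq_op, PiecewiseSymbol.op_sub]
  rw [dist_eq_norm, e]
  refine h2.trans_lt ?_
  rw [← Finset.sum_mul, ← mul_assoc, ← one_add_mul, ← hS, ← div_div, mul_div_assoc',
    mul_div_cancel₀ _ hS0.ne', div_mul_eq_mul_div, div_lt_iff₀ hφ1]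
  exact mul_lt_mul_of_pos_left (lt_add_one _) hε

lemma fourier_moment_eq_zero {s : ℝ} {r : ℕ} (φ ψ : WeightedSobolev s r)
    {t : ℝ} (ht : t ≠ 0) (hψ : ψ.toL2 = group t φ.toL2) (j : ℕ) (hj : j + 3 ≤ r) :
    𝓕 (φ.moment j : ℝ → ℂ) 0 = 0 := by
  induction j using Nat.strong_induction_on with
  | _ j ih =>
  -- Below order `j + 2`, a symbol derivative of order at least two only meets moments of index less
  -- than `j`, which vanish by induction.
  have hX : ∀ k < j + 2, IsMulX ((groupSymbol t).leibniz φ.moment k)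
      ((groupSymbol t).leibniz φ.moment (k + 1)) := by
    intro k hk
    refine (groupSymbol t).isMulX_leibniz (fun i hi ↦ φ.isMulX_moment (by omega)) fun i l hil ↦ ?_
    unfold PiecewiseSymbol.Compatible
    rcases lt_or_ge i 2 with hi | hi
    · rw [groupSymbol_pos_eq_neg t hi]
    · rw [ih l (by omega) (by omega), mul_zero, mul_zero]
  have heq : (groupSymbol t).leibniz φ.moment (j + 2) = ψ.moment (j + 2) := by
    refine Lp.ext ?_
    filter_upwards [ae_eq_pow_mul hX, ψ.coeFn_moment (k := j + 2) (by omega)] with x h1 h2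
    rw [h1, h2, PiecewiseSymbol.leibniz_zero, φ.moment_zero, ← group_eq_op, hψ]
  have hsum := (groupSymbol t).sum_jump_eq_zero (f := φ.moment) (k := j + 2)
    (fun i hi ↦ φ.integrable_moment (by omega))
    (heq ▸ ψ.integrable_moment (by omega))
  -- Terms with `i < 2` have no jump, and those with `i > 2` carry a moment of index less than `j`.
  rw [Finset.sum_eq_single (2, j)] at hsum
  · rw [groupSymbol_jump] at hsum
    have hch : ((j + 2).choose 2 : ℂ) ≠ 0 := by
      exact_mod_cast (Nat.choose_pos (by omega)).ne'
    simpa [hch, Real.pi_ne_zero, ht] using hsum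
  · rintro ⟨i, l⟩ hp hne
    have hil : i + l = j + 2 := Finset.HasAntidiagonal.mem_antidiagonal.1 hp
    rcases lt_or_ge i 2 with hi | hi
    · rw [groupSymbol_pos_eq_neg t hi, sub_self]
      ring
    · have hlj : l ≠ j := by
        rintro rfl
        exact hne (by simp; omega)
      rw [ih l (by omega) (by omega)]
      ring
  · intro h
    exact absurd (Finset.HasAntidiagonal.mem_antidiagonal.2 (by omega)) h

lemma momentsVanish_of_groupContinuous {s : ℝ} {r : ℕ} (φ : WeightedSobolev s r)
    (h : GroupContinuous φ) : MomentsVanish r φ.toL2 := by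
  obtain ⟨u, hu⟩ := h
  exact φ.momentsVanish_iff.2 fun j hj ↦
    fourier_moment_eq_zero φ (u ⟨1, mem_Ici.2 zero_le_one⟩) one_ne_zero (hu _) j hj

end RBO

end

theorem theorem2p5 :
    (∀ r : ℕ, r ≤ 2 →
      ∃ P : Polynomial ℝ, RBO.IsPositivePolynomial r P ∧
        ∀ s : ℝ, (r : ℝ) ≤ s → ∀ φ : RBO.WeightedSobolev s r, RBO.GroupBound P φ) ∧
    (∀ r : ℕ, 3 ≤ r →
      (∀ s : ℝ, (r : ℝ) ≤ s → ∀ φ : RBO.WeightedSobolev s r,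
        RBO.GroupContinuous φ ↔ RBO.MomentsVanish r φ.toL2) ∧
      ∃ P : Polynomial ℝ, RBO.IsPositivePolynomial r P ∧
        ∀ s : ℝ, (r : ℝ) ≤ s → ∀ φ : RBO.WeightedSobolev s r,
          RBO.MomentsVanish r φ.toL2 → RBO.GroupBound P φ) := by
  refine ⟨fun r hr ↦ ?_, fun r _ ↦ ⟨fun s hs φ ↦ ?_, ?_⟩⟩
  · obtain ⟨P, hP, hb⟩ := RBO.exists_groupBound r
    -- For `r ≤ 2` the moment conditions are vacuous.
    exact ⟨P, hP, fun s hs φ ↦ hb s (r.cast_nonneg.trans hs) φ fun j hj ↦ by omega⟩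
  · exact ⟨RBO.momentsVanish_of_groupContinuous φ,
      RBO.groupContinuous_of_momentsVanish (r.cast_nonneg.trans hs) φ⟩
  · obtain ⟨P, hP, hb⟩ := RBO.exists_groupBound r
    exact ⟨P, hP, fun s hs φ hφ ↦ hb s (r.cast_nonneg.trans hs) φ hφ⟩
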